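/- **Setting.** Consider an episodic MDP $M=(\mathcal S,\mathcal A,H,\mathbb P,r)$ with fixed initial state $s_1$, deterministic rewards and $\sum_{h=1}^H r_h(s_h,a_h)\in[0,1]$ for every sequence of states and actions. Put $\eta_h=(s_h,a_h)$, $\zeta_h=s_{h+1}$, and write $\mathbb E_{\zeta_h}$ for the expectation over $s_{h+1}\sim\mathbb P_h(\cdot\mid\eta_h)$. Let $\mathcal F\subseteq\mathcal G$ be hypothesis classes. Each $f\in\mathcal F$ has action-value functions $Q_{h,f}$, a greedy policy $\pi_f$, and $V_{h,f}(s)=\mathbb E_{a\sim\pi_{h,f}(s)}Q_{h,f}(s,a)$, and some $f^*\in\mathcal F$ satisfies $Q_{h,f^*}=Q_h^*$, $V_{h,f^*}=V_h^*$ for all $h$ (the optimal value functions). Let $\ell_{h,f'}(\zeta_h,\eta_h,f,g)$ ($f',f\in\mathcal F$, $g\in\mathcal G$) be a vector-valued loss with $\|\ell\|_2\le R$, $R>0$. Fix $K\ge 2$. $(M,\mathcal F,\mathcal G,\ell,d,\kappa)$ ($d,\kappa\ge 0$) is an *$\ell_2$-type EC class* (for $K$ episodes, with eluder constant $C_e>0$,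 which may depend on $R$) if for every $\beta'\ge R^2$ and $h\in[H]$: (i) for all $f^1,\dots,f^K\in\mathcal F$ and all data $\eta_h^1,\dots,\eta_h^K$: if $\sum_{i=1}^{k-1}\|\mathbb E_{\zeta_h}\ell_{h,f^i}(\zeta_h,\eta_h^i,f^k,f^k)\|_2^2\le\beta'$ for all $k\in[K]$, then $\sum_{i=1}^{k}\|\mathbb E_{\zeta_h}\ell_{h,f^i}(\zeta_h,\eta_h^i,f^i,f^i)\|_2^2\le C_e\,d\,\beta'\log k$ for all $2\le k\le K$; (ii) for all $f^1,\dots,f^K\in\mathcal F$ with executed policies $\pi_i=\pi_{f^i}$ and all $k\in[K]$: $\sum_{i=1}^k\big(V_{1,f^i}(s_1)-V_1^{\pi_i}(s_1)\big)\le\kappa\sum_{h=1}^H\sum_{i=1}^k\mathbb E_{\eta_h\sim\pi_i}\big\|\mathbb E_{\zeta_h}\ell_{h,f^i}(\zeta_h,\eta_h,f^i,f^i)\big\|_2$. The loss is *decomposable* if there is $\mathcal T:\mathcal F\to\mathcal G$ with $\mathcal T(f^*)=f^*$ and $\ell_{h,f'}(\zeta_h,\eta_h,f,g)-\mathbb E_{\zeta_h}\ell_{h,f'}(\zeta_h,\eta_h,f,g)=\ell_{h,f'}(\zeta_h,\eta_h,f,\mathcal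 T(f))$ always. Let $\mathcal N_{\mathcal L}(1/K)$ be the $1/K$-covering number (assumed finite) in the supremum norm of the class of the functions $(f',\zeta_h,\eta_h)\mapsto\ell_{h,f'}(\zeta_h,\eta_h,f,g)$, indexed by $h\in[H]$, $f\in\mathcal F$, $g\in\mathcal G$: the least size of a finite subset of the class such that every member is within $1/K$, uniformly in $(f',\zeta_h,\eta_h)$, of a member of the subset. **Algorithm $\ell_2$-EC-RS** (with parameter $\beta$). Let $\mathscr B^0=\mathcal F$. In episode $k=1,2,\dots,K$ choose $f^k\in\arg\max_{f\in\mathscr B^{k-1}}V_{1,f}(s_1)$ (assumed to be attained if $\mathscr B^{k-1}\neq\emptyset$), execute $\pi^k=\pi_{f^k}$ and observe $(\zeta_h^k,\eta_h^k)_{h\in[H]}$. Put $L_h^{1:k}(f,g)=\sum_{i=1}^k\|\ell_{h,f^i}(\zeta_h^i,\eta_h^i,f,g)\|_2^2$. If $L_h^{1:k}(f^k,f^k)-\inf_{g\in\mathcal G}L_h^{1:k}(f^k,g)\ge5\beta$ for some $h$, let $\mathscr B^k=\{f\in\mathcal F:L_h^{1:k}(f,f)-\inf_{g\in\mathcal G}L_h^{1:k}(f,g)\le\beta\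 \ \forall h\in[H]\}$; otherwise $\mathscr B^k=\mathscr B^{k-1}$ and $f^{k+1}=f^k$. ($f^{K+1}$ is selected from $\mathscr B^K$ in the same way; if a confidence set is empty, an arbitrary hypothesis is selected.) **Zero-sum Markov games.** The same definitions apply to a two-player zero-sum Markov game, with $\eta_h=(s_h,a_h,b_h)$, with $\pi_f=(\upsilon_f,\mu_f)$ a Nash pair of the stage games $Q_{h,f}(s,\cdot,\cdot)$ (bounded), with $V^*,Q^*$ the values of a Nash equilibrium of the game, and with executed policies $\pi^k=(\upsilon_{f^k},\mu^k)$, where $\mu^k$ is any Markov policy chosen by an adaptive adversary; in (ii), $\pi_i=(\upsilon_{f^i},\mu^i)$ for arbitrary Markov policies $\mu^i$. **Theorem 1.** There are universal constants $c_0>0$ and $p\in\mathbb N$, and for each $C_e>0$ a constant $C>0$ that depends only on $C_e$, such that the following holds for every $\ell_2$-type EC class with decomposable loss, every $\delta\in(0,1)$ and every $c\ge c_0$. Run $\ell_2$-EC-RS with $\beta=c(R^2\iota+R)$, $\iota=\log\big(HK^2\mathcal N_{\mathcal L}(1/K)/\delta\big)$. Then with probability at least $1-\delta$, simultaneously $$R(K)=\sum_{k=1}^K\big(V_1^*(s_1)-V_1^{\pi^k}(s_1)\big)\le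 C\,\kappa H\sqrt{d\beta K}\,(\log K)^p\quad\text{and}\quad N_{\mathrm{switch}}(K)\le C\,dH\log K,$$ where $N_{\mathrm{switch}}(K)=\sum_{k=1}^K\mathbb 1\{\pi^k\ne\pi^{k+1}\}$ for an MDP and $N_{\mathrm{switch}}(K)=\sum_{k=1}^K\mathbb 1\{\upsilon^k\ne\upsilon^{k+1}\}$, $\upsilon^k=\upsilon_{f^k}$, for a zero-sum Markov game. -/

import Mathlib

open MeasureTheory ProbabilityTheory

noncomputable section

namespace EC

/-! ### Episodic models, policies, trajectories

Steps are numbered `0, …, H - 1` and episodes `0, …, K - 1`. A model has a state space `S` and a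
space `Act` of (joint) actions: `Act = A` for an MDP, `Act = A × B` for a two-player zero-sum
Markov game. Transitions, rewards and policies are families over `ℕ`, of which only the members
with index `< H` are ever used. -/

/-- A finite-horizon episodic model with deterministic rewards and a fixed initial state. -/
structure Model (S Act : Type*) [MeasurableSpace S] [MeasurableSpace Act] (H : ℕ) where
  P : ℕ → Kernel (S × Act) S
  markov : ∀ h, IsMarkovKernel (P h)
  r : ℕ → S × Act → ℝ
  measurable_r : ∀ h, Measurable (r h)
  sum_r_mem : ∀ z : Fin H → S × Act, ∑ h : Fin H, r h (z h) ∈ Set.Icc (0 : ℝ) 1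
  s₁ : S

/-- A (possibly randomized) Markov policy. -/
structure Policy (S Act : Type*) [MeasurableSpace S] [MeasurableSpace Act] where
  act : ℕ → Kernel S Act
  markov : ∀ h, IsMarkovKernel (act h)

/-- The joint policy `(υ, μ)` of two players who draw their actions independently. -/
def Policy.joint {S A B : Type*} [MeasurableSpace S] [MeasurableSpace A] [MeasurableSpace B]
    (υ : Policy S A) (μ : Policy S B) : Policy S (A × B) where
  act h := υ.act h ×ₖ μ.act h
  markov h := by
    have := υ.markov h
    have := μ.markov h
    infer_instance

/-- The two policies coincide at each of the `H` steps of an episode. -/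
def Policy.SameOn {S Act : Type*} [MeasurableSpace S] [MeasurableSpace Act] (H : ℕ)
    (π π' : Policy S Act) : Prop :=
  ∀ h < H, π.act h = π'.act h

/-- A trajectory: the state-action pairs of the `H` steps, and the state reached at the end. -/
abbrev Traj (S Act : Type*) (H : ℕ) : Type _ := (Fin H → S × Act) × S

/-- `ζ_h`: the state that follows step `h`. -/
def Traj.next {S Act : Type*} {H : ℕ} (τ : Traj S Act H) (h : Fin H) : S :=
  if hh : (h : ℕ) + 1 < H then (τ.1 ⟨h + 1, hh⟩).1 else τ.2

section Values

variable {S Act : Type*} [MeasurableSpace S] [MeasurableSpace Act] {H : ℕ}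

/-- One step of the interaction at time `i`: after a path that ends in the state `s`, draw
`a ∼ π_i(s)` and then `s' ∼ P_i(s, a)`. -/
def stepKernel (M : Model S Act H) (π : Policy S Act) (i n : ℕ) :
    Kernel ((Fin n → S × Act) × S) (Act × S) :=
  ((π.act i) ⊗ₖ (M.P i)).comap Prod.snd measurable_snd

/-- The law of the next `n` steps (and the final state) when `π` is executed from the state `s`
at time `h`. -/
def pathLaw (M : Model S Act H) (π : Policy S Act) (h : ℕ) (s : S) :
    (n : ℕ) → Measure (Traj S Act n)
  | 0 => Measure.dirac (Fin.elim0, s)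
  | n + 1 => (pathLaw M π h s n ⊗ₘ stepKernel M π (h + n) n).map
      (fun p => (Fin.snoc (α := fun _ => S × Act) p.1.1 (p.1.2, p.2.1), p.2.2))

/-- The law of a whole episode under `π`. -/
def trajLaw (M : Model S Act H) (π : Policy S Act) : Measure (Traj S Act H) :=
  pathLaw M π 0 M.s₁ H

/-- `V^π_h(s) = E_π[∑_{h' ≥ h} r_{h'}(s_{h'}, a_{h'}) | s_h = s]`. -/
def value (M : Model S Act H) (π : Policy S Act) (h : ℕ) (s : S) : ℝ :=
  ∫ τ, ∑ j : Fin (H - h), M.r (h + j) (τ.1 j) ∂(pathLaw M π h s (H - h))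

/-- `Q^π_h(s, a)`. -/
def qvalue (M : Model S Act H) (π : Policy S Act) (h : ℕ) (z : S × Act) : ℝ :=
  M.r h z + ∫ s', value M π (h + 1) s' ∂(M.P h z)

/-- `V_{h,f}(s) = E_{a ∼ π_{h,f}(s)}[Q_{h,f}(s, a)]` for a hypothesis with action-value function
`Q` and policy `π`. -/
def hypValue (Q : ℕ → S × Act → ℝ) (π : Policy S Act) (h : ℕ) (s : S) : ℝ :=
  ∫ a, Q h (s, a) ∂(π.act h s)

end Values

/-! ### Optimality in MDPs, Nash equilibria in zero-sum Markov games -/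

section MDP

variable {S A : Type*} [MeasurableSpace S] [MeasurableSpace A] {H : ℕ}

/-- `π` is an optimal policy of the MDP. -/
def IsOptimal (M : Model S A H) (π : Policy S A) : Prop :=
  ∀ (π' : Policy S A) (h : ℕ) (s : S), value M π' h s ≤ value M π h s

/-- `π` is greedy with respect to `Q`: it only plays actions that maximize `Q_h(s, ·)`. -/
def IsGreedy (H : ℕ) (Q : ℕ → S × A → ℝ) (π : Policy S A) : Prop :=
  ∀ h < H, ∀ s, ∀ᵐ a ∂(π.act h s), ∀ a', Q h (s, a') ≤ Q h (s, a)

end MDP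

section Game

variable {S A B : Type*} [MeasurableSpace S] [MeasurableSpace A] [MeasurableSpace B] {H : ℕ}

/-- `(υ, μ)` is a Nash equilibrium of the zero-sum Markov game, the first player maximizing. -/
def IsNash (M : Model S (A × B) H) (υ : Policy S A) (μ : Policy S B) : Prop :=
  (∀ (υ' : Policy S A) (h : ℕ) (s : S),
      value M (υ'.joint μ) h s ≤ value M (υ.joint μ) h s) ∧
  (∀ (μ' : Policy S B) (h : ℕ) (s : S),
      value M (υ.joint μ) h s ≤ value M (υ.joint μ') h s)

/-- `Q` is bounded and measurable, and `(υ, μ)` is at each step and each state a Nash equilibrium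
of the one-shot zero-sum game with payoff `Q_h(s, ·, ·)`. -/
structure IsStageNash (H : ℕ) (Q : ℕ → S × (A × B) → ℝ) (υ : Policy S A) (μ : Policy S B) :
    Prop where
  measurable : ∀ h < H, Measurable (Q h)
  bounded : ∀ h < H, ∃ b, ∀ z, |Q h z| ≤ b
  max_player : ∀ h < H, ∀ s, ∀ x : ProbabilityMeasure A,
    ∫ ab, Q h (s, ab) ∂((x : Measure A).prod (μ.act h s)) ≤ hypValue Q (υ.joint μ) h s
  min_player : ∀ h < H, ∀ s, ∀ y : ProbabilityMeasure B,
    hypValue Q (υ.joint μ) h s ≤ ∫ ab, Q h (s, ab) ∂((υ.act h s).prod (y : Measure B))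

end Game

/-! ### Loss functions, decomposability, the `ℓ₂`-type eluder-condition class

`𝓖` is the type of all hypotheses of the larger class and `𝓕 : Set 𝓖` the smaller class.
`ℓ h f' η ζ f g` is the loss `ℓ_{h,f'}(ζ_h, η_h, f, g)`. -/

section Loss

variable {S Act : Type*} [MeasurableSpace S] [MeasurableSpace Act] {H m : ℕ}
  {𝓖 : Type*} {𝓕 : Set 𝓖}

/-- Vector-valued loss functions. -/
abbrev Loss (S Act : Type*) (H m : ℕ) {𝓖 : Type*} (𝓕 : Set 𝓖) : Type _ :=
  Fin H → 𝓕 → S × Act → S → 𝓕 → 𝓖 → EuclideanSpace ℝ (Fin m)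

/-- `E_{ζ_h}[ℓ_{h,f'}(ζ_h, η, f, g)]`, with `ζ_h ∼ P_h(η)`. -/
def meanLoss (M : Model S Act H) (ℓ : Loss S Act H m 𝓕) (h : Fin H) (f' : 𝓕) (η : S × Act)
    (f : 𝓕) (g : 𝓖) : EuclideanSpace ℝ (Fin m) :=
  ∫ s', ℓ h f' η s' f g ∂(M.P h η)

/-- Measurability of the loss in the data and in the hypothesis that indexes it. -/
structure MeasurableLoss [MeasurableSpace 𝓖] (ℓ : Loss S Act H m 𝓕) : Prop where
  fixed : ∀ (h : Fin H) (f : 𝓕) (g : 𝓖),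
    Measurable (fun x : 𝓕 × (S × Act) × S => ℓ h x.1 x.2.1 x.2.2 f g)
  diag : ∀ h : Fin H, Measurable (fun x : 𝓕 × (S × Act) × S => ℓ h x.1 x.2.1 x.2.2 x.1 x.1)

/-- The loss is decomposable, through an operator that fixes `fstar`. -/
def IsDecomposable (M : Model S Act H) (ℓ : Loss S Act H m 𝓕) (fstar : 𝓕) : Prop :=
  ∃ T : 𝓕 → 𝓖, T fstar = fstar ∧
    ∀ (h : Fin H) (f' f : 𝓕) (g : 𝓖) (η : S × Act) (ζ : S),
      ℓ h f' η ζ f g - meanLoss M ℓ h f' η f g = ℓ h f' η ζ f (T f)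

/-- The quantitative conditions of an `ℓ₂`-type eluder-condition class, for `K` episodes.
`V₁ f` stands for `V_{1,f}(s₁)`, and `Exec f` is the set of the joint policies that may be executed
when the learner has selected `f`. `Ce` is the constant of the `O(·)` in the eluder condition;
the case `k = 1`, where `log k = 0`, is left out there. -/
structure IsEllTwoEC (M : Model S Act H) (ℓ : Loss S Act H m 𝓕) (V₁ : 𝓕 → ℝ)
    (Exec : 𝓕 → Set (Policy S Act)) (K : ℕ) (R Ce d κ : ℝ) : Prop where
  bounded : ∀ (h : Fin H) (f' : 𝓕) (η : S × Act) (ζ : S) (f : 𝓕) (g : 𝓖), ‖ℓ h f' η ζ f g‖ ≤ R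
  eluder : ∀ β : ℝ, R ^ 2 ≤ β → ∀ (h : Fin H) (f : ℕ → 𝓕) (η : ℕ → S × Act),
    (∀ k < K, ∑ i ∈ Finset.range k, ‖meanLoss M ℓ h (f i) (η i) (f k) (f k)‖ ^ 2 ≤ β) →
    ∀ k, 2 ≤ k → k ≤ K →
      ∑ i ∈ Finset.range k, ‖meanLoss M ℓ h (f i) (η i) (f i) (f i)‖ ^ 2
        ≤ Ce * (d * β * Real.log k)
  dominance : ∀ (f : ℕ → 𝓕) (π : ℕ → Policy S Act), (∀ i, π i ∈ Exec (f i)) → ∀ k ≤ K,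
    ∑ i ∈ Finset.range k, (V₁ (f i) - value M (π i) 0 M.s₁)
      ≤ κ * ∑ h : Fin H, ∑ i ∈ Finset.range k,
          ∫ τ, ‖meanLoss M ℓ h (f i) (τ.1 h) (f i) (f i)‖ ∂(trajLaw M (π i))

/-- The class of the functions `(f', η, ζ) ↦ ℓ_{h,f'}(ζ, η, f, g)`, indexed by `(h, f, g)`. -/
def lossClass (ℓ : Loss S Act H m 𝓕) :
    Set (𝓕 × (S × Act) × S → EuclideanSpace ℝ (Fin m)) :=
  {φ | ∃ (h : Fin H) (f : 𝓕) (g : 𝓖), φ = fun x => ℓ h x.1 x.2.1 x.2.2 f g}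

end Loss

/-- `C` is a finite `ρ`-cover of the function class `L` in the supremum norm. -/
def IsSupCover {X E : Type*} [NormedAddCommGroup E] (L : Set (X → E)) (ρ : ℝ)
    (C : Finset (X → E)) : Prop :=
  (C : Set (X → E)) ⊆ L ∧ ∀ φ ∈ L, ∃ ψ ∈ C, ∀ x, ‖φ x - ψ x‖ ≤ ρ

/-- The `ρ`-covering number in the supremum norm (meaningful if there is a finite cover). -/
def coveringNumber {X E : Type*} [NormedAddCommGroup E] (L : Set (X → E)) (ρ : ℝ) : ℕ :=
  sInf {t | ∃ C : Finset (X → E), IsSupCover L ρ C ∧ C.card = t}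

/-! ### The algorithm -/

section Algorithm

variable {S Act : Type*} [MeasurableSpace S] [MeasurableSpace Act] {H m : ℕ}
  {𝓖 : Type*} {𝓕 : Set 𝓖}

/-- The empirical loss at step `h` of `(f, g)` on the first `k` episodes. -/
def empLoss (ℓ : Loss S Act H m 𝓕) (fs : ℕ → 𝓕) (τ : ℕ → Traj S Act H) (h : Fin H) (k : ℕ)
    (f : 𝓕) (g : 𝓖) : ℝ :=
  ∑ i ∈ Finset.range k, ‖ℓ h (fs i) ((τ i).1 h) ((τ i).next h) f g‖ ^ 2

/-- The excess empirical loss of `f` over the best `g ∈ 𝓖`. -/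
def excess (ℓ : Loss S Act H m 𝓕) (fs : ℕ → 𝓕) (τ : ℕ → Traj S Act H) (h : Fin H) (k : ℕ)
    (f : 𝓕) : ℝ :=
  empLoss ℓ fs τ h k f f - ⨅ g : 𝓖, empLoss ℓ fs τ h k f g

/-- A run of the lazy-switching algorithm over `K` episodes. In episode `k` the hypothesis `fs k` is
selected from the confidence set `conf k`, then the trajectory `τ k` is observed. If the set is not
updated after an episode, the same maximizer is returned again; if a confidence set is empty (there
is no maximizer then), any hypothesis may be returned. -/
structure IsRun (ℓ : Loss S Act H m 𝓕) (V₁ : 𝓕 → ℝ) (β : ℝ) (K : ℕ)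
    (fs : ℕ → 𝓕) (conf : ℕ → Set 𝓕) (τ : ℕ → Traj S Act H) : Prop where
  init : conf 0 = Set.univ
  select : ∀ k ≤ K, (conf k).Nonempty → fs k ∈ conf k ∧ ∀ f ∈ conf k, V₁ f ≤ V₁ (fs k)
  update : ∀ k < K, (∃ h, 5 * β ≤ excess ℓ fs τ h (k + 1) (fs k)) →
    conf (k + 1) = {f | ∀ h, excess ℓ fs τ h (k + 1) f ≤ β}
  keep : ∀ k < K, (¬ ∃ h, 5 * β ≤ excess ℓ fs τ h (k + 1) (fs k)) →
    conf (k + 1) = conf k ∧ fs (k + 1) = fs k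

/-- The interaction of the algorithm with the model on a probability space: `π k` is the joint policy
executed in episode `k`, and given the past `ℱ k` the trajectory `τ k` has the law of an episode
under `π k`. The past contains the earlier trajectories and the hypothesis selected in episode `k`;
it may contain additional randomness, such as that of an opponent. -/
structure IsInteraction [MeasurableSpace 𝓖] {Ω : Type*} [mΩ : MeasurableSpace Ω] (Pr : Measure Ω)
    (ℱ : Filtration ℕ mΩ) (M : Model S Act H)
    (ℓ : Loss S Act H m 𝓕) (V₁ : 𝓕 → ℝ) (β : ℝ) (K : ℕ) (fs : ℕ → Ω → 𝓕)
    (conf : ℕ → Ω → Set 𝓕) (π : ℕ → Ω → Policy S Act) (τ : ℕ → Ω → Traj S Act H) : Prop where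
  run : ∀ᵐ ω ∂Pr, IsRun ℓ V₁ β K (fun k => fs k ω) (fun k => conf k ω) (fun k => τ k ω)
  measurable_fs : ∀ k < K, Measurable[ℱ k] (fs k)
  measurable_traj : ∀ k < K, Measurable[ℱ (k + 1)] (τ k)
  law : ∀ k < K, ∀ C : Set (Traj S Act H), MeasurableSet C →
    Pr[(τ k ⁻¹' C).indicator (fun _ => (1 : ℝ)) | ℱ k]
      =ᵐ[Pr] fun ω => (trajLaw M (π k ω)).real C

/-- The regret after `K` episodes against the value `v`, when `π k` is executed in episode `k`. -/
def regret (M : Model S Act H) (v : ℝ) (π : ℕ → Policy S Act) (K : ℕ) : ℝ :=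
  ∑ k ∈ Finset.range K, (v - value M (π k) 0 M.s₁)

end Algorithm

open Classical in
/-- The number of the episodes `k` among the first `K` for which the policy of the next episode
differs from that of episode `k`. -/
def switchCost {S A : Type*} [MeasurableSpace S] [MeasurableSpace A] (H : ℕ)
    (π : ℕ → Policy S A) (K : ℕ) : ℕ :=
  ((Finset.range K).filter (fun k => ¬ (π k).SameOn H (π (k + 1)))).card

/-! ### Eluder-condition classes of MDPs and of zero-sum Markov games -/

/-- `(M, 𝓕, 𝓖, ℓ, d, κ)` is an `ℓ₂`-type eluder-condition class of an MDP. A hypothesis `f` has the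
action-value function `Q f` and the greedy policy `pol f`; `fstar` realizes the value functions of
the optimal policy `πstar`. -/
structure IsMDPClass {S A : Type*} [MeasurableSpace S] [MeasurableSpace A] {H m : ℕ} {𝓖 : Type*}
    {𝓕 : Set 𝓖} (M : Model S A H) (πstar : Policy S A) (Q : 𝓕 → ℕ → S × A → ℝ)
    (pol : 𝓕 → Policy S A) (fstar : 𝓕) (ℓ : Loss S A H m 𝓕) (K : ℕ) (R Ce d κ : ℝ) : Prop where
  optimal : IsOptimal M πstar
  greedy : ∀ f, IsGreedy H (Q f) (pol f)
  realizable_Q : ∀ h < H, Q fstar h = qvalue M πstar h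
  realizable_V : ∀ h < H, hypValue (Q fstar) (pol fstar) h = value M πstar h
  ec : IsEllTwoEC M ℓ (fun f => hypValue (Q f) (pol f) 0 M.s₁) (fun f => {pol f}) K R Ce d κ

/-- `(M, 𝓕, 𝓖, ℓ, d, κ)` is an `ℓ₂`-type eluder-condition class of a decoupled zero-sum Markov game.
A hypothesis `f` has the action-value function `Q f` and the Nash policy pair `(polA f, polB f)`;
`fstar` realizes the value functions of the Nash equilibrium `(υstar, μstar)`. When the learner has
selected `f`, the max-player plays `polA f` and the min-player may play any policy. -/
structure IsGameClass {S A B : Type*} [MeasurableSpace S] [MeasurableSpace A] [MeasurableSpace B]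
    {H m : ℕ} {𝓖 : Type*} {𝓕 : Set 𝓖} (M : Model S (A × B) H) (υstar : Policy S A)
    (μstar : Policy S B) (Q : 𝓕 → ℕ → S × (A × B) → ℝ) (polA : 𝓕 → Policy S A)
    (polB : 𝓕 → Policy S B) (fstar : 𝓕) (ℓ : Loss S (A × B) H m 𝓕) (K : ℕ) (R Ce d κ : ℝ) :
    Prop where
  nash : IsNash M υstar μstar
  stage_nash : ∀ f, IsStageNash H (Q f) (polA f) (polB f)
  realizable_Q : ∀ h < H, Q fstar h = qvalue M (υstar.joint μstar) h
  realizable_V : ∀ h < H,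
    hypValue (Q fstar) ((polA fstar).joint (polB fstar)) h = value M (υstar.joint μstar) h
  ec : IsEllTwoEC M ℓ (fun f => hypValue (Q f) ((polA f).joint (polB f)) 0 M.s₁)
    (fun f => {π | ∃ μ : Policy S B, π = (polA f).joint μ}) K R Ce d κ

end EC

end

/-! # Regret and switching cost of lazy-switching exploration in `ℓ₂`-type eluder-condition classes

For a member `φ` of the loss class let `avg φ` be its mean over the next state. Decomposability says
that `φ - avg φ` is the loss of the pair `(f, T f)`, so that the difference of the empirical losses of
`(f, g)` and `(f, T f)` is the sum of `‖φ‖² - ‖φ - avg φ‖² = ‖avg φ‖² + cross`, where `cross` is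
centered and bounded by `4 R ‖avg φ‖`. Its sums therefore obey a Bernstein-type bound: up to a term
`O(R² ι)` they are at most a quarter of `∑ ‖avg φ‖²` (`measure_not_concentrated_le`). A cover of the
loss class makes this uniform in the hypotheses at an additional cost of `O(R)`
(`concentrated_of_cover`), and both terms are small compared with `β`.

On this event the algorithm is analyzed deterministically. The excess loss of `fstar` is at most
`β / 20`, so `fstar` never leaves the confidence sets, and the selected hypotheses are optimistic
(`IsRun.optimism`). The excess loss of the selected hypothesis is at most `5 β`, hence its squared mean
losses on the past data sum to at most `7 β` (`IsRun.sumSq_le`), and the eluder condition bounds the sum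
of the squared mean losses of the selected hypotheses on their own data by `7 Ce d β log K` at each
step. An update triggered at step `h` raises the excess loss from at most `β` at the preceding update
to at least `5 β`; the hypothesis was the same in between, so that this sum grows by at least `β`
(`IsRun.exists_last_update`). This bounds the number of switches.

For the regret, optimism and the dominance condition reduce the claim to expected norms of mean
losses. Azuma's inequality compares these with the realized norms, which are bounded through the
Cauchy-Schwarz inequality by the same sum (`IsEllTwoEC.sum_integral_le`). The Azuma term `R √(ι K)`
does not contain `d`. It is absorbed if `Ce d log K ≥ 1`; otherwise the eluder condition for constant
sequences shows that all mean losses are small (`IsEllTwoEC.mul_normSq_meanLoss_le`).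

The executed policies need not be measurable functions of the past, as the opponent is arbitrary. Only
the conditional probability of each event is known, up to null sets. The freezing lemma
`IsCondLaw.exists_lintegral_section` extends this to integrands that depend on the past, which is what
the exponential supermartingales need (`measure_le_sum_le_exp`). -/

namespace EC

/-! ### Conditional laws and exponential supermartingales -/

section CondLaw

open scoped ENNReal

variable {Ω T : Type*} {m mΩ : MeasurableSpace Ω} [mT : MeasurableSpace T]

/-- The random measure `ν` is the conditional law of `X` given `m`. No measurability of `ν` in `ω` is
assumed; it holds up to null sets, one event at a time. -/
def IsCondLaw (Pr : Measure Ω) (m : MeasurableSpace Ω) (X : Ω → T) (ν : Ω → Measure T) : Prop :=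
  ∀ C : Set T, MeasurableSet C →
    Pr[(X ⁻¹' C).indicator (fun _ => (1 : ℝ)) | m] =ᵐ[Pr] fun ω => (ν ω).real C

variable {Pr : Measure Ω} [IsProbabilityMeasure Pr] {X : Ω → T}
  {ν : Ω → Measure T} [∀ ω, IsProbabilityMeasure (ν ω)]

theorem measurable_prodMk_of_le (hm : m ≤ mΩ) (hX : Measurable X) :
    Measurable[mΩ, m.prod mT] (fun ω => (ω, X ω)) :=
  @Measurable.prodMk Ω mΩ Ω T m mT _ _ (measurable_id'' hm) hX

theorem IsCondLaw.exists_measure_section (hm : m ≤ mΩ) (hX : Measurable X)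
    (h : IsCondLaw Pr m X ν) {s : Set (Ω × T)} (hs : MeasurableSet[m.prod mT] s) :
    ∃ g : Ω → ℝ≥0∞, Measurable[m] g ∧ (∀ᵐ ω ∂Pr, ν ω (Prod.mk ω ⁻¹' s) = g ω) ∧
      Pr {ω | (ω, X ω) ∈ s} = ∫⁻ ω, g ω ∂Pr := by
  have hsec : ∀ ω, ∀ s, MeasurableSet[m.prod mT] s → MeasurableSet (Prod.mk ω ⁻¹' s) :=
    fun ω s hs => (@measurable_prodMk_left Ω T m mT ω) hs
  refine MeasurableSpace.induction_on_inter (m := m.prod mT)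
    (C := fun s _ => ∃ g : Ω → ℝ≥0∞, Measurable[m] g ∧ (∀ᵐ ω ∂Pr, ν ω (Prod.mk ω ⁻¹' s) = g ω) ∧
      Pr {ω | (ω, X ω) ∈ s} = ∫⁻ ω, g ω ∂Pr)
    (@generateFrom_prod Ω T m mT).symm (@isPiSystem_prod Ω T m mT) ?_ ?_ ?_ ?_ s hs
  · exact ⟨fun _ => 0, @measurable_const _ _ _ m _, by simp, by simp⟩
  · rintro _ ⟨A, hA, C, hC, rfl⟩
    have hA' : MeasurableSet[m] A := hA
    have hC' : MeasurableSet C := hC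
    have hXC : MeasurableSet (X ⁻¹' C) := hX hC'
    have hint : Integrable ((X ⁻¹' C).indicator (fun _ => (1 : ℝ))) Pr :=
      (integrable_const _).indicator hXC
    set e := Pr[(X ⁻¹' C).indicator (fun _ => (1 : ℝ)) | m] with he
    have hem : Measurable[m] e := stronglyMeasurable_condExp.measurable
    have he0 : 0 ≤ᵐ[Pr] e := by
      filter_upwards [h C hC'] with ω hω
      rw [he, hω]; exact measureReal_nonneg
    refine ⟨A.indicator (fun ω => ENNReal.ofReal (e ω)), ?_, ?_, ?_⟩
    · exact (ENNReal.measurable_ofReal.comp hem).indicator hA'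
    · filter_upwards [h C hC'] with ω hω
      by_cases hω' : ω ∈ A
      · have : Prod.mk ω ⁻¹' (A ×ˢ C) = C := by ext t; simp [hω']
        rw [this, Set.indicator_of_mem hω', he, hω, ofReal_measureReal]
      · have : Prod.mk ω ⁻¹' (A ×ˢ C) = ∅ := by ext t; simp [hω']
        rw [this, Set.indicator_of_notMem hω', measure_empty]
    · rw [lintegral_indicator (hm _ hA'), ← ofReal_integral_eq_lintegral_ofReal
        integrable_condExp.restrict (ae_restrict_of_ae he0), setIntegral_condExp hm hint hA',
        integral_indicator (f := fun _ => (1 : ℝ)) hXC, Measure.restrict_restrict hXC]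
      simp only [integral_const, MeasurableSet.univ, measureReal_restrict_apply, Set.univ_inter,
        smul_eq_mul, mul_one]
      rw [ofReal_measureReal]
      congr 1
      ext ω
      simp [and_comm]
  · rintro t ht ⟨g, hg, hg1, hg2⟩
    refine ⟨fun ω => 1 - g ω, ?_, ?_, ?_⟩
    · exact Measurable.const_sub hg 1
    · filter_upwards [hg1] with ω hω
      rw [Set.preimage_compl, prob_compl_eq_one_sub (hsec ω t ht), hω]
    · have hle : g ≤ᵐ[Pr] fun _ => 1 := by
        filter_upwards [hg1] with ω hω
        rw [← hω]; exact prob_le_one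
      have hfin : ∫⁻ ω, g ω ∂Pr ≠ ∞ := by rw [← hg2]; exact measure_ne_top _ _
      rw [lintegral_sub (hg.mono hm le_rfl) hfin hle, ← hg2]
      have hms : MeasurableSet {ω | (ω, X ω) ∈ t} := measurable_prodMk_of_le hm hX ht
      have := prob_compl_eq_one_sub (μ := Pr) hms
      rw [lintegral_one, measure_univ]
      exact this
  · intro f hd hf ih
    choose g hg hg1 hg2 using ih
    refine ⟨fun ω => ∑' n, g n ω, ?_, ?_, ?_⟩
    · simp_rw [ENNReal.tsum_eq_iSup_sum]
      exact .iSup fun s => Finset.measurable_fun_sum s fun i _ => hg i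
    · filter_upwards [ae_all_iff.2 hg1] with ω hω
      rw [Set.preimage_iUnion, measure_iUnion _ (fun n => hsec ω _ (hf n))]
      · exact tsum_congr hω
      · exact fun i j hij => (hd hij).preimage _
    · rw [lintegral_tsum (fun n => ((hg n).mono hm le_rfl).aemeasurable)]
      simp_rw [← hg2]
      rw [← measure_iUnion]
      · congr 1; ext ω; simp
      · intro i j hij
        exact (hd hij).preimage (fun ω => (ω, X ω))
      · exact fun n => measurable_prodMk_of_le hm hX (hf n)

/-- Freezing lemma: given `m`, the expectation of `G ω (X ω)` is the integral of `G ω` under the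
conditional law of `X`. -/
theorem IsCondLaw.exists_lintegral_section (hm : m ≤ mΩ) (hX : Measurable X)
    (h : IsCondLaw Pr m X ν) {G : Ω × T → ℝ≥0∞} (hG : Measurable[m.prod mT] G) :
    ∃ g : Ω → ℝ≥0∞, Measurable[m] g ∧ (∀ᵐ ω ∂Pr, ∫⁻ t, G (ω, t) ∂ν ω = g ω) ∧
      ∫⁻ ω, G (ω, X ω) ∂Pr = ∫⁻ ω, g ω ∂Pr := by
  have hsec : ∀ ω, Measurable[mT, m.prod mT] (Prod.mk ω : T → Ω × T) :=
    fun ω => @measurable_prodMk_left Ω T m mT ω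
  have hgr := measurable_prodMk_of_le hm hX
  refine @Measurable.ennreal_induction (Ω × T) (m.prod mT) (fun G => ∃ g : Ω → ℝ≥0∞,
    Measurable[m] g ∧ (∀ᵐ ω ∂Pr, ∫⁻ t, G (ω, t) ∂ν ω = g ω) ∧
      ∫⁻ ω, G (ω, X ω) ∂Pr = ∫⁻ ω, g ω ∂Pr) ?_ ?_ ?_ G hG
  · intro c s hs
    obtain ⟨g, hg, hg1, hg2⟩ := h.exists_measure_section hm hX hs
    refine ⟨fun ω => c * g ω, hg.const_mul c, ?_, ?_⟩
    · filter_upwards [hg1] with ω hω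
      have : (fun t => s.indicator (fun _ => c) (ω, t))
          = (Prod.mk ω ⁻¹' s).indicator (fun _ => c) := rfl
      rw [this, lintegral_indicator_const (hsec ω hs), hω]
    · have : (fun ω => s.indicator (fun _ => c) (ω, X ω))
          = {ω | (ω, X ω) ∈ s}.indicator (fun _ => c) := rfl
      have hms : MeasurableSet {ω | (ω, X ω) ∈ s} := hgr hs
      rw [this, lintegral_indicator_const hms, hg2,
        lintegral_const_mul _ (hg.mono hm le_rfl)]
  · rintro f f' - hf hf' ⟨g, hg, hg1, hg2⟩ ⟨g', hg', hg1', hg2'⟩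
    refine ⟨fun ω => g ω + g' ω, hg.add hg', ?_, ?_⟩
    · filter_upwards [hg1, hg1'] with ω hω hω'
      have hfω : Measurable fun t => f (ω, t) := hf.comp (hsec ω)
      simp only [Pi.add_apply]
      rw [lintegral_add_left hfω, hω, hω']
    · have hfX : Measurable fun ω => f (ω, X ω) := hf.comp hgr
      simp only [Pi.add_apply]
      rw [lintegral_add_left hfX, hg2, hg2',
        lintegral_add_left (hg.mono hm le_rfl)]
  · intro f hf hmono ih
    choose g hg hg1 hg2 using ih
    refine ⟨fun ω => ⨆ n, g n ω, Measurable.iSup hg, ?_, ?_⟩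
    · filter_upwards [ae_all_iff.2 hg1] with ω hω
      have hfω : ∀ n, Measurable fun t => f n (ω, t) := fun n => (hf n).comp (hsec ω)
      rw [lintegral_iSup hfω (fun i j hij t => hmono hij _)]
      exact iSup_congr hω
    · have hfX : ∀ n, Measurable fun ω => f n (ω, X ω) := fun n => (hf n).comp hgr
      rw [lintegral_iSup hfX (fun i j hij ω => hmono hij _),
        lintegral_iSup_ae (fun n => (hg n).mono hm le_rfl)]
      · exact iSup_congr hg2
      · intro n
        filter_upwards [hg1 n, hg1 (n + 1)] with ω h1 h2
        rw [← h1, ← h2]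
        exact lintegral_mono fun t => hmono (Nat.le_succ n) _

end CondLaw

section Chernoff

open scoped ENNReal

variable {Ω T : Type*} {mΩ : MeasurableSpace Ω} [mT : MeasurableSpace T]
  {Pr : Measure Ω} [IsProbabilityMeasure Pr] {ℱ : Filtration ℕ mΩ} {X : ℕ → Ω → T}
  {ν : ℕ → Ω → Measure T} [∀ k ω, IsProbabilityMeasure (ν k ω)] {K : ℕ}

/-- A product of factors, each of which has a conditional expectation of at most `1`, has an
expectation of at most `1`. Measurability is part of the claim, for the induction. -/
theorem lintegral_prod_le_one (hX : ∀ k < K, Measurable[ℱ (k + 1)] (X k))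
    (hlaw : ∀ k < K, IsCondLaw Pr (ℱ k) (X k) (ν k)) {G : ℕ → Ω × T → ℝ≥0∞}
    (hG : ∀ k < K, Measurable[(ℱ k).prod mT] (G k))
    (hG1 : ∀ k < K, ∀ᵐ ω ∂Pr, ∫⁻ t, G k (ω, t) ∂ν k ω ≤ 1) (k : ℕ) (hk : k ≤ K) :
    Measurable[ℱ k] (fun ω => ∏ i ∈ Finset.range k, G i (ω, X i ω)) ∧
      ∫⁻ ω, ∏ i ∈ Finset.range k, G i (ω, X i ω) ∂Pr ≤ 1 := by
  induction k with
  | zero => simp [measurable_const]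
  | succ k ih =>
    obtain ⟨ihm, ih⟩ := ih (by omega)
    have hk' : k < K := hk
    have hXk : Measurable (X k) := (hX k hk').mono (ℱ.le _) le_rfl
    have hgr : Measurable[ℱ (k + 1), (ℱ k).prod mT] (fun ω => (ω, X k ω)) :=
      @Measurable.prodMk Ω (ℱ (k + 1)) Ω T (ℱ k) mT _ _ (measurable_id'' (ℱ.mono (Nat.le_succ k))) (hX k hk')
    simp_rw [Finset.prod_range_succ]
    refine ⟨?_, ?_⟩
    · exact Measurable.mul (ihm.mono (ℱ.mono (Nat.le_succ k)) le_rfl) ((hG k hk').comp hgr)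
    · have hGZ : Measurable[(ℱ k).prod mT] (fun p : Ω × T =>
          (∏ i ∈ Finset.range k, G i (p.1, X i p.1)) * G k p) :=
        Measurable.mul (ihm.comp (@measurable_fst Ω T (ℱ k) mT)) (hG k hk')
      obtain ⟨g, hg, hg1, hg2⟩ := (hlaw k hk').exists_lintegral_section (ℱ.le k) hXk hGZ
      rw [hg2]
      refine le_trans (lintegral_mono_ae ?_) ih
      filter_upwards [hg1, hG1 k hk'] with ω h1 h2
      rw [← h1, lintegral_const_mul]
      · exact mul_le_of_le_one_right' h2
      · exact (hG k hk').comp (@measurable_prodMk_left Ω T (ℱ k) mT ω)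

/-- Chernoff's bound for a sum of terms `D k`, each of which has a conditional exponential moment of
at most `1`. -/
theorem measure_le_sum_le_exp (hX : ∀ k < K, Measurable[ℱ (k + 1)] (X k))
    (hlaw : ∀ k < K, IsCondLaw Pr (ℱ k) (X k) (ν k)) {D : ℕ → Ω × T → ℝ}
    (hD : ∀ k < K, Measurable[(ℱ k).prod mT] (D k))
    (hD1 : ∀ k < K, ∀ᵐ ω ∂Pr, ∫⁻ t, ENNReal.ofReal (Real.exp (D k (ω, t))) ∂ν k ω ≤ 1)
    {k : ℕ} (hk : k ≤ K) (x : ℝ) :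
    Pr {ω | x ≤ ∑ i ∈ Finset.range k, D i (ω, X i ω)} ≤ ENNReal.ofReal (Real.exp (-x)) := by
  obtain ⟨hm, h1⟩ := lintegral_prod_le_one hX hlaw
    (G := fun k p => ENNReal.ofReal (Real.exp (D k p)))
    (fun k hk => ENNReal.measurable_ofReal.comp (Real.measurable_exp.comp (hD k hk))) hD1 k hk
  have hpos : ENNReal.ofReal (Real.exp x) ≠ 0 := by simp [Real.exp_pos]
  have hmarkov := mul_meas_ge_le_lintegral₀ (hm.mono (ℱ.le k) le_rfl).aemeasurable (μ := Pr)
    (ENNReal.ofReal (Real.exp x))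
  have hset : {ω | x ≤ ∑ i ∈ Finset.range k, D i (ω, X i ω)} = {ω | ENNReal.ofReal (Real.exp x) ≤
      ∏ i ∈ Finset.range k, ENNReal.ofReal (Real.exp (D i (ω, X i ω)))} := by
    ext ω
    simp only [Set.mem_ofPred_eq]
    rw [← ENNReal.ofReal_prod_of_nonneg (fun _ _ => (Real.exp_pos _).le), ← Real.exp_sum,
      ENNReal.ofReal_le_ofReal_iff (Real.exp_pos _).le, Real.exp_le_exp]
  rw [hset, Real.exp_neg, ENNReal.ofReal_inv_of_pos (Real.exp_pos _)]
  rw [ENNReal.le_inv_iff_mul_le, mul_comm]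
  exact hmarkov.trans h1

end Chernoff

/-- Hoeffding's lemma for a centered variable of absolute value at most `v`. -/
theorem lintegral_exp_le_of_abs_le {T : Type*} [MeasurableSpace T] {ν : Measure T}
    [IsProbabilityMeasure ν] {Y : T → ℝ} (hY : Measurable Y) {v : ℝ} (hv : ∀ t, |Y t| ≤ v)
    (h0 : ∫ t, Y t ∂ν = 0) {w : ℝ} (hw : v ^ 2 / 2 ≤ w) :
    ∫⁻ t, ENNReal.ofReal (Real.exp (Y t - w)) ∂ν ≤ 1 := by
  have hsub := hasSubgaussianMGF_of_mem_Icc_of_integral_eq_zero (μ := ν) (a := -v) (b := v)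
    hY.aemeasurable (.of_forall fun t => abs_le.1 (hv t)) h0
  have hint := hsub.integrable_exp_mul 1
  have hmgf := hsub.mgf_le 1
  simp only [mgf, one_mul] at hint hmgf
  rw [← ofReal_integral_eq_lintegral_ofReal _ (.of_forall fun t => (Real.exp_pos _).le)]
  · rw [ENNReal.ofReal_le_one]
    simp_rw [sub_eq_add_neg, Real.exp_add]
    rw [integral_mul_const]
    calc _ ≤ Real.exp w * Real.exp (-w) := by
          refine mul_le_mul_of_nonneg_right (hmgf.trans (Real.exp_le_exp.2 ?_)) (Real.exp_pos _).le
          refine le_trans (le_of_eq ?_) hw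
          have : ((((‖v - -v‖₊ / 2) ^ 2 : NNReal)) : ℝ) = v ^ 2 := by
            push_cast
            rw [Real.norm_eq_abs, show v - -v = 2 * v by ring, abs_mul, abs_two,
              mul_div_cancel_left₀ _ two_ne_zero, sq_abs]
          rw [this]; ring
      _ = 1 := by rw [← Real.exp_add]; simp
  · simp_rw [sub_eq_add_neg, Real.exp_add]
    exact hint.mul_const _

/-- Azuma's inequality for the conditional means of variables with values in `[0, b]`. -/
theorem measure_le_sum_integral_sub_le_exp {Ω T : Type*} {mΩ : MeasurableSpace Ω}
    [mT : MeasurableSpace T] {Pr : Measure Ω} [IsProbabilityMeasure Pr] {ℱ : Filtration ℕ mΩ}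
    {X : ℕ → Ω → T} {ν : ℕ → Ω → Measure T} [∀ k ω, IsProbabilityMeasure (ν k ω)] {K : ℕ}
    (hX : ∀ k < K, Measurable[ℱ (k + 1)] (X k))
    (hlaw : ∀ k < K, IsCondLaw Pr (ℱ k) (X k) (ν k)) {F : ℕ → Ω × T → ℝ} {b : ℝ}
    (hF : ∀ k < K, Measurable[(ℱ k).prod mT] (F k)) (hF0 : ∀ k p, 0 ≤ F k p)
    (hFb : ∀ k p, F k p ≤ b) {k : ℕ} (hk : k ≤ K) (x : ℝ) :
    Pr {ω | x ≤ ∑ i ∈ Finset.range k,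
        (∫ t, F i (ω, t) ∂ν i ω - F i (ω, X i ω) - b ^ 2 / 2)} ≤ ENNReal.ofReal (Real.exp (-x)) := by
  have hsec : ∀ i < K, ∀ ω, Measurable (fun t => F i (ω, t)) := fun i hi ω =>
    (hF i hi).comp (@measurable_prodMk_left Ω T (ℱ i) mT ω)
  have hex : ∀ i, ∃ g : Ω → ℝ, i < K → Measurable[ℱ i] g ∧
      ∀ᵐ ω ∂Pr, ∫ t, F i (ω, t) ∂ν i ω = g ω := by
    intro i
    by_cases hi : i < K
    · have hXi : Measurable (X i) := (hX i hi).mono (ℱ.le _) le_rfl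
      obtain ⟨g, hg, hg1, -⟩ := (hlaw i hi).exists_lintegral_section (ℱ.le i) hXi
        (G := fun p => ENNReal.ofReal (F i p)) (ENNReal.measurable_ofReal.comp (hF i hi))
      refine ⟨fun ω => (g ω).toReal, fun _ => ⟨ENNReal.measurable_toReal.comp hg, ?_⟩⟩
      filter_upwards [hg1] with ω hω
      rw [← hω, integral_eq_lintegral_of_nonneg_ae (.of_forall fun t => hF0 i _)
        (hsec i hi ω).aestronglyMeasurable]
    · exact ⟨fun _ => 0, fun h => absurd h hi⟩
  choose g hg using hex
  have hmain := measure_le_sum_le_exp hX hlaw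
    (D := fun i p => g i p.1 - F i p - b ^ 2 / 2) ?_ ?_ hk x
  · refine le_trans (measure_mono_ae ?_) hmain
    have hall : ∀ᵐ ω ∂Pr, ∀ i, i < K → ∫ t, F i (ω, t) ∂ν i ω = g i ω := by
      rw [ae_all_iff]
      intro i
      by_cases hi : i < K
      · filter_upwards [(hg i hi).2] with ω hω _ using hω
      · exact .of_forall fun ω h => absurd h hi
    filter_upwards [hall] with ω hω h
    refine le_trans h (Finset.sum_le_sum fun i hi => ?_)
    rw [hω i ((Finset.mem_range.1 hi).trans_le hk)]
  · intro i hi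
    exact Measurable.sub_const (Measurable.sub
      ((hg i hi).1.comp (@measurable_fst Ω T (ℱ i) mT)) (hF i hi)) _
  · intro i hi
    filter_upwards [(hg i hi).2] with ω hω
    have hint : Integrable (fun t => F i (ω, t)) (ν i ω) :=
      Integrable.of_mem_Icc 0 b (hsec i hi ω).aemeasurable
        (.of_forall fun t => ⟨hF0 i _, hFb i _⟩)
    have h0 : 0 ≤ ∫ t, F i (ω, t) ∂ν i ω := integral_nonneg fun t => hF0 i _
    have h1 : ∫ t, F i (ω, t) ∂ν i ω ≤ b := by
      calc _ ≤ ∫ _, b ∂ν i ω := integral_mono hint (integrable_const _) fun t => hFb i _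
        _ = b := by simp
    refine lintegral_exp_le_of_abs_le (v := b) ((hsec i hi ω).const_sub _) (fun t => ?_) ?_ le_rfl
    · rw [← hω, abs_le]
      constructor <;> linarith [hF0 i (ω, t), hFb i (ω, t)]
    · rw [integral_sub (integrable_const _) hint, hω]
      simp

/-! ### The law of a trajectory -/

theorem Traj.next_snoc_castSucc {S Act : Type*} {n : ℕ} (t : Traj S Act n) (a : Act) (s : S) (j : Fin n) :
    Traj.next ((Fin.snoc (α := fun _ => S × Act) t.1 (t.2, a), s) : Traj S Act (n + 1)) j.castSucc
      = t.next j := by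
  have hj : (j.castSucc : ℕ) + 1 < n + 1 := by simp
  unfold Traj.next
  rw [dif_pos hj]
  split_ifs with h
  · have : (⟨(j.castSucc : ℕ) + 1, hj⟩ : Fin (n + 1)) = (⟨j + 1, h⟩ : Fin n).castSucc := rfl
    simp only [this, Fin.snoc_castSucc]
  · have : (⟨(j.castSucc : ℕ) + 1, hj⟩ : Fin (n + 1)) = Fin.last n := by
      ext; simp only [Fin.val_castSucc, Fin.val_last]; omega
    simp only [this, Fin.snoc_last]

section Path

variable {S Act : Type*} [MeasurableSpace S] [MeasurableSpace Act] {H : ℕ}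

instance isMarkovKernel_stepKernel (M : Model S Act H) (π : Policy S Act) (i n : ℕ) :
    IsMarkovKernel (stepKernel M π i n) := by
  have := M.markov i
  have := π.markov i
  unfold stepKernel
  infer_instance

theorem measurable_snoc (n : ℕ) :
    Measurable (fun p : ((Fin n → S × Act) × S) × (Act × S) =>
      ((Fin.snoc (α := fun _ => S × Act) p.1.1 (p.1.2, p.2.1), p.2.2) : Traj S Act (n + 1))) := by
  refine Measurable.prodMk (measurable_pi_iff.2 fun j => ?_) (by fun_prop)
  refine Fin.lastCases ?_ (fun j => ?_) j
  · simp only [Fin.snoc_last]; fun_prop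
  · simp only [Fin.snoc_castSucc]; fun_prop

instance isProbabilityMeasure_pathLaw (M : Model S Act H) (π : Policy S Act) (h : ℕ) (s : S)
    (n : ℕ) : IsProbabilityMeasure (pathLaw M π h s n) := by
  induction n with
  | zero => unfold pathLaw; infer_instance
  | succ n ih =>
    unfold pathLaw
    exact Measure.isProbabilityMeasure_map (measurable_snoc n).aemeasurable

instance isProbabilityMeasure_trajLaw (M : Model S Act H) (π : Policy S Act) :
    IsProbabilityMeasure (trajLaw M π) := by
  unfold trajLaw; infer_instance

theorem Traj.measurable_next (j : Fin H) :
    Measurable (fun τ : Traj S Act H => τ.next j) := by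
  unfold Traj.next
  split_ifs <;> fun_prop

theorem Traj.measurable_step (j : Fin H) :
    Measurable (fun τ : Traj S Act H => (τ.1 j, τ.next j)) :=
  Measurable.prodMk (by fun_prop) (Traj.measurable_next j)

/-- Given the state and action at step `j`, the next state is drawn from the transition kernel; here
only the resulting inequality for expectations is recorded. -/
theorem lintegral_pathLaw_le_one (M : Model S Act H) (π : Policy S Act) (h : ℕ) (s : S) {n : ℕ}
    (j : Fin n) {G : (S × Act) × S → ENNReal} (hG : Measurable G)
    (hG1 : ∀ z, ∫⁻ s', G (z, s') ∂M.P (h + j) z ≤ 1) :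
    ∫⁻ τ, G (τ.1 j, τ.next j) ∂pathLaw M π h s n ≤ 1 := by
  induction n with
  | zero => exact j.elim0
  | succ n ih =>
    have hGm : Measurable fun τ : Traj S Act (n + 1) => G (τ.1 j, τ.next j) :=
      hG.comp (Traj.measurable_step j)
    unfold pathLaw
    have hGs := hGm.comp (measurable_snoc n)
    simp only [Function.comp_def] at hGs
    rw [lintegral_map hGm (measurable_snoc n), Measure.lintegral_compProd hGs]
    revert hG1 hGm
    refine Fin.lastCases (fun hG1 _ => ?_) (fun j hG1 _ => ?_) j
    · have hnext : ∀ t : Traj S Act (n + 1), t.next (Fin.last n) = t.2 := fun t => by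
        simp [Traj.next]
      have := M.markov (h + n)
      have := π.markov (h + n)
      simp only [Fin.snoc_last, hnext]
      calc _ ≤ ∫⁻ _, 1 ∂pathLaw M π h s n := by
            refine lintegral_mono fun t => ?_
            simp only [stepKernel, Kernel.comap_apply]
            rw [Kernel.lintegral_compProd _ _ _ (by fun_prop)]
            calc _ ≤ ∫⁻ _, 1 ∂π.act (h + n) t.2 := lintegral_mono fun a => hG1 (t.2, a)
              _ = 1 := by simp
        _ = 1 := by simp
    · simp only [Fin.snoc_castSucc, Traj.next_snoc_castSucc, lintegral_const, measure_univ, mul_one]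
      exact ih j hG1

end Path

/-! ### Concentration of the losses along the interaction -/

section Loss

variable {S Act F : Type*} [MeasurableSpace S] [MeasurableSpace Act] {H m : ℕ}

/-- The mean of the loss `φ` over the transition at step `h`. -/
noncomputable def avg (M : Model S Act H) (h : Fin H) (φ : F × (S × Act) × S → EuclideanSpace ℝ (Fin m)) (f : F)
    (η : S × Act) : EuclideanSpace ℝ (Fin m) :=
  ∫ s', φ (f, η, s') ∂(M.P h η)

/-- The centered part of `‖φ‖ ^ 2 - ‖φ - avg φ‖ ^ 2`, of which the mean is `‖avg φ‖ ^ 2`. -/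
noncomputable def cross (M : Model S Act H) (h : Fin H) (φ : F × (S × Act) × S → EuclideanSpace ℝ (Fin m)) (f : F)
    (η : S × Act) (s' : S) : ℝ :=
  2 * inner ℝ (φ (f, η, s') - avg M h φ f η) (avg M h φ f η)

theorem normSq_sub_normSq_sub_avg (M : Model S Act H) (h : Fin H)
    (φ : F × (S × Act) × S → EuclideanSpace ℝ (Fin m)) (f : F) (η : S × Act) (s' : S) :
    ‖φ (f, η, s')‖ ^ 2 - ‖φ (f, η, s') - avg M h φ f η‖ ^ 2
      = ‖avg M h φ f η‖ ^ 2 + cross M h φ f η s' := by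
  unfold cross
  rw [norm_sub_sq_real, inner_sub_left, real_inner_self_eq_norm_sq]
  ring

variable {M : Model S Act H} {h : Fin H} {φ ψ : F × (S × Act) × S → EuclideanSpace ℝ (Fin m)}
  {R : ℝ}

theorem norm_avg_le (hb : ∀ x, ‖φ x‖ ≤ R) (f : F) (η : S × Act) : ‖avg M h φ f η‖ ≤ R := by
  have := M.markov h
  calc _ ≤ R * (M.P h η).real Set.univ := norm_integral_le_of_norm_le_const (.of_forall fun _ => hb _)
    _ = R := by simp

theorem abs_cross_le (hb : ∀ x, ‖φ x‖ ≤ R) (f : F) (η : S × Act) (s' : S) :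
    |cross M h φ f η s'| ≤ 4 * R * ‖avg M h φ f η‖ := by
  have h1 : ‖φ (f, η, s') - avg M h φ f η‖ ≤ 2 * R := by
    calc _ ≤ ‖φ (f, η, s')‖ + ‖avg M h φ f η‖ := norm_sub_le _ _
      _ ≤ 2 * R := by linarith [hb (f, η, s'), norm_avg_le (M := M) (h := h) hb f η]
  have h2 := abs_real_inner_le_norm (φ (f, η, s') - avg M h φ f η) (avg M h φ f η)
  have h3 := mul_le_mul_of_nonneg_right h1 (norm_nonneg (avg M h φ f η))
  unfold cross
  rw [abs_mul, abs_two]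
  linarith

variable [MeasurableSpace F]

theorem measurable_avg (hφ : Measurable φ) :
    Measurable (fun p : F × (S × Act) => avg M h φ p.1 p.2) := by
  have := M.markov h
  have hm : StronglyMeasurable (fun q : (F × (S × Act)) × S => φ (q.1.1, q.1.2, q.2)) :=
    (hφ.comp (by fun_prop)).stronglyMeasurable
  exact (hm.integral_kernel_prod_right'
    (κ := (M.P h).comap (Prod.snd : F × (S × Act) → S × Act) measurable_snd)).measurable

theorem measurable_cross (hφ : Measurable φ) :
    Measurable (fun p : F × (S × Act) × S => cross M h φ p.1 p.2.1 p.2.2) := by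
  have h1 : Measurable (fun p : F × (S × Act) × S => avg M h φ p.1 p.2.1) :=
    (measurable_avg hφ).comp (g := fun p : F × (S × Act) => avg M h φ p.1 p.2)
      (f := fun p : F × (S × Act) × S => (p.1, p.2.1)) (by fun_prop)
  exact ((hφ.sub h1).inner h1).const_mul 2

theorem integrable_loss (hφ : Measurable φ) (hb : ∀ x, ‖φ x‖ ≤ R) (f : F) (η : S × Act) :
    Integrable (fun s' => φ (f, η, s')) (M.P h η) := by
  have := M.markov h
  exact Integrable.of_bound (hφ.comp (by fun_prop)).aestronglyMeasurable R
    (.of_forall fun _ => hb _)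

theorem norm_avg_sub_avg_le (hφ : Measurable φ) (hb : ∀ x, ‖φ x‖ ≤ R) (hψ : Measurable ψ)
    (hb' : ∀ x, ‖ψ x‖ ≤ R) {ρ : ℝ} (hd : ∀ x, ‖φ x - ψ x‖ ≤ ρ) (f : F) (η : S × Act) :
    ‖avg M h φ f η - avg M h ψ f η‖ ≤ ρ := by
  have := M.markov h
  unfold avg
  rw [← integral_sub (integrable_loss hφ hb f η) (integrable_loss hψ hb' f η)]
  calc _ ≤ ρ * (M.P h η).real Set.univ := norm_integral_le_of_norm_le_const (.of_forall fun _ => hd _)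
    _ = ρ := by simp

theorem integral_cross (hφ : Measurable φ) (hb : ∀ x, ‖φ x‖ ≤ R) (f : F) (η : S × Act) :
    ∫ s', cross M h φ f η s' ∂M.P h η = 0 := by
  have := M.markov h
  have hint := integrable_loss (M := M) (h := h) hφ hb f η
  unfold cross
  rw [integral_const_mul]
  simp_rw [real_inner_comm (avg M h φ f η)]
  have hint' : Integrable (fun s' => φ (f, η, s') - avg M h φ f η) (M.P h η) :=
    hint.sub (integrable_const _)
  rw [integral_inner hint', integral_sub hint (integrable_const _)]
  simp [avg]

theorem abs_normSq_avg_sub_le (hφ : Measurable φ) (hb : ∀ x, ‖φ x‖ ≤ R) (hψ : Measurable ψ)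
    (hb' : ∀ x, ‖ψ x‖ ≤ R) {ρ : ℝ} (hd : ∀ x, ‖φ x - ψ x‖ ≤ ρ) (f : F) (η : S × Act) :
    |‖avg M h φ f η‖ ^ 2 - ‖avg M h ψ f η‖ ^ 2| ≤ 2 * R * ρ := by
  have h1 := norm_avg_sub_avg_le (M := M) (h := h) hφ hb hψ hb' hd f η
  have h2 := abs_norm_sub_norm_le (avg M h φ f η) (avg M h ψ f η)
  have h3 := norm_avg_le (M := M) (h := h) hb f η
  have h4 := norm_avg_le (M := M) (h := h) hb' f η
  rw [sq_sub_sq, abs_mul, abs_of_nonneg (by positivity)]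
  exact mul_le_mul (by linarith) (h2.trans h1) (abs_nonneg _)
    (by linarith [norm_nonneg (avg M h φ f η)])

theorem abs_cross_sub_le (hφ : Measurable φ) (hb : ∀ x, ‖φ x‖ ≤ R) (hψ : Measurable ψ)
    (hb' : ∀ x, ‖ψ x‖ ≤ R) {ρ : ℝ} (hd : ∀ x, ‖φ x - ψ x‖ ≤ ρ) (f : F) (η : S × Act) (s' : S) :
    |cross M h φ f η s' - cross M h ψ f η s'| ≤ 8 * R * ρ := by
  have h1 := norm_avg_sub_avg_le (M := M) (h := h) hφ hb hψ hb' hd f η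
  have h3 := norm_avg_le (M := M) (h := h) hb f η
  have h4 := norm_avg_le (M := M) (h := h) hb' f η
  have h5 := hb' (f, η, s')
  have h6 := hd (f, η, s')
  unfold cross
  set a := avg M h φ f η
  set b := avg M h ψ f η
  set u := φ (f, η, s')
  set v := ψ (f, η, s')
  have key : 2 * inner ℝ (u - a) a - 2 * inner ℝ (v - b) b
      = 2 * (inner ℝ ((u - v) - (a - b)) a + inner ℝ (v - b) (a - b)) := by
    simp only [inner_sub_left, inner_sub_right]; ring
  have e1 := abs_real_inner_le_norm ((u - v) - (a - b)) a
  have e2 := abs_real_inner_le_norm (v - b) (a - b)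
  have e3 : ‖(u - v) - (a - b)‖ * ‖a‖ ≤ (2 * ρ) * R :=
    mul_le_mul ((norm_sub_le _ _).trans (by linarith)) h3 (norm_nonneg _)
      (by linarith [norm_nonneg (u - v)])
  have e4 : ‖v - b‖ * ‖a - b‖ ≤ (2 * R) * ρ :=
    mul_le_mul ((norm_sub_le _ _).trans (by linarith)) h1 (norm_nonneg _)
      (by linarith [norm_nonneg a])
  rw [key, abs_mul, abs_two]
  linarith [abs_add_le (inner ℝ ((u - v) - (a - b)) a) (inner ℝ (v - b) (a - b))]

end Loss

section Interaction

variable {S Act F Ω : Type*} [MeasurableSpace S] [MeasurableSpace Act] [MeasurableSpace F]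
  {mΩ : MeasurableSpace Ω} {H m K : ℕ} {Pr : Measure Ω} [IsProbabilityMeasure Pr]
  {ℱ : Filtration ℕ mΩ} {M : Model S Act H} {fs : ℕ → Ω → F} {π : ℕ → Ω → Policy S Act}
  {τ : ℕ → Ω → Traj S Act H} {φ : F × (S × Act) × S → EuclideanSpace ℝ (Fin m)} {R : ℝ}

/-- A Bernstein-type tail bound for the sums of the centered losses, in terms of the squared norms of
the conditional means. Both tails are covered, through the sign `σ`. -/
theorem measure_le_sum_cross_le_exp (hfs : ∀ k < K, Measurable[ℱ k] (fs k))
    (hτ : ∀ k < K, Measurable[ℱ (k + 1)] (τ k))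
    (hlaw : ∀ k < K, IsCondLaw Pr (ℱ k) (τ k) (fun ω => trajLaw M (π k ω)))
    (hφ : Measurable φ) (hR : 0 < R) (hb : ∀ x, ‖φ x‖ ≤ R) (h : Fin H) {σ : ℝ} (hσ : |σ| = 1)
    {k : ℕ} (hk : k ≤ K) (x : ℝ) :
    Pr {ω | x ≤ ∑ i ∈ Finset.range k,
        (σ / (32 * R ^ 2) * cross M h φ (fs i ω) ((τ i ω).1 h) ((τ i ω).next h)
          - ‖avg M h φ (fs i ω) ((τ i ω).1 h)‖ ^ 2 / (128 * R ^ 2))}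
      ≤ ENNReal.ofReal (Real.exp (-x)) := by
  let c : F × (S × Act) × S → ℝ := fun p =>
    σ / (32 * R ^ 2) * cross M h φ p.1 p.2.1 p.2.2 - ‖avg M h φ p.1 p.2.1‖ ^ 2 / (128 * R ^ 2)
  have hc : Measurable c := by
    have h1 : Measurable (fun p : F × (S × Act) × S => avg M h φ p.1 p.2.1) :=
      (measurable_avg hφ).comp (g := fun p : F × (S × Act) => avg M h φ p.1 p.2)
        (f := fun p : F × (S × Act) × S => (p.1, p.2.1)) (by fun_prop)
    exact ((measurable_cross hφ).const_mul _).sub ((h1.norm.pow_const 2).div_const _)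
  refine measure_le_sum_le_exp (ν := fun k ω => trajLaw M (π k ω)) hτ hlaw
    (D := fun i p => c (fs i p.1, p.2.1 h, p.2.next h)) ?_ ?_ hk x
  · intro i hi
    have hmap : Measurable[(ℱ i).prod inferInstance] (fun p : Ω × Traj S Act H =>
        (fs i p.1, p.2.1 h, p.2.next h)) :=
      Measurable.prodMk ((hfs i hi).comp (@measurable_fst _ _ (ℱ i) _))
        ((Traj.measurable_step h).comp (@measurable_snd _ _ (ℱ i) _))
    exact Measurable.comp (g := c) hc hmap
  · intro i hi
    refine .of_forall fun ω => ?_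
    have := M.markov h
    refine lintegral_pathLaw_le_one M (π i ω) 0 M.s₁ h
      (G := fun q => ENNReal.ofReal (Real.exp (c (fs i ω, q)))) ?_ fun z => ?_
    · have hmap : Measurable fun q : (S × Act) × S => (fs i ω, q) := by fun_prop
      exact ENNReal.measurable_ofReal.comp (Real.measurable_exp.comp
        (Measurable.comp (g := c)
        (f := fun q : (S × Act) × S => (fs i ω, q)) hc hmap))
    · rw [Nat.zero_add]
      have hmap : Measurable fun s' : S => (fs i ω, z, s') := by fun_prop
      have hcz : Measurable fun s' => cross M h φ (fs i ω) z s' :=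
        Measurable.comp (g := fun p : F × (S × Act) × S => cross M h φ p.1 p.2.1 p.2.2)
          (f := fun s' : S => (fs i ω, z, s')) (measurable_cross hφ) hmap
      refine lintegral_exp_le_of_abs_le (ν := M.P h z)
        (Y := fun s' => σ / (32 * R ^ 2) * cross M h φ (fs i ω) z s')
        (v := ‖avg M h φ (fs i ω) z‖ / (8 * R))
        (w := ‖avg M h φ (fs i ω) z‖ ^ 2 / (128 * R ^ 2)) (hcz.const_mul _) (fun s' => ?_) ?_ ?_
      · have h1 := abs_cross_le (M := M) (h := h) hb (fs i ω) z s'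
        rw [abs_mul, abs_div, hσ, abs_of_pos (by positivity)]
        calc _ ≤ 1 / (32 * R ^ 2) * (4 * R * ‖avg M h φ (fs i ω) z‖) := by gcongr
          _ = _ := by field_simp; ring
      · have h0 := integral_cross (M := M) (h := h) hφ hb (fs i ω) z
        rw [integral_const_mul, h0, mul_zero]
      · refine le_of_eq ?_
        field_simp; ring

/-- Azuma's inequality for a bounded function of the selected hypothesis and of the data of step
`h`. -/
theorem measure_le_sum_integral_traj_sub_le_exp (hfs : ∀ k < K, Measurable[ℱ k] (fs k))
    (hτ : ∀ k < K, Measurable[ℱ (k + 1)] (τ k))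
    (hlaw : ∀ k < K, IsCondLaw Pr (ℱ k) (τ k) (fun ω => trajLaw M (π k ω)))
    {W : F × (S × Act) → ℝ} (hW : Measurable W) (hW0 : ∀ p, 0 ≤ W p) (hWR : ∀ p, W p ≤ R)
    (h : Fin H) {t : ℝ} (ht : 0 ≤ t) (x : ℝ) :
    Pr {ω | x ≤ ∑ i ∈ Finset.range K, (t * (∫ τ', W (fs i ω, τ'.1 h) ∂trajLaw M (π i ω)
          - W (fs i ω, (τ i ω).1 h)) - (t * R) ^ 2 / 2)} ≤ ENNReal.ofReal (Real.exp (-x)) := by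
  have := measure_le_sum_integral_sub_le_exp (ν := fun k ω => trajLaw M (π k ω)) hτ hlaw
    (F := fun i p => t * W (fs i p.1, p.2.1 h)) (b := t * R) ?_ ?_ ?_ le_rfl x
  · simpa only [integral_const_mul, mul_sub] using this
  · intro i hi
    have hmap : Measurable[(ℱ i).prod inferInstance] (fun p : Ω × Traj S Act H =>
        (fs i p.1, p.2.1 h)) := by
      have hsnd : Measurable fun τ : Traj S Act H => τ.1 h := by fun_prop
      exact Measurable.prodMk ((hfs i hi).comp (@measurable_fst _ _ (ℱ i) _))
        (hsnd.comp (@measurable_snd _ _ (ℱ i) _))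
    exact Measurable.const_mul (hW.comp hmap) t
  · exact fun i p => mul_nonneg ht (hW0 _)
  · exact fun i p => mul_le_mul_of_nonneg_left (hWR _) ht

theorem measure_exists_finset_le {Ω ι : Type*} [MeasurableSpace Ω] {Pr : Measure Ω} (s : Finset ι)
    {B : ι → Set Ω} {a : ℝ} (hB : ∀ i ∈ s, Pr (B i) ≤ ENNReal.ofReal a) :
    Pr {ω | ∃ i ∈ s, ω ∈ B i} ≤ ENNReal.ofReal (s.card * a) := by
  have : {ω | ∃ i ∈ s, ω ∈ B i} = ⋃ i ∈ s, B i := by ext ω; simp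
  rw [this]
  calc _ ≤ ∑ i ∈ s, Pr (B i) := measure_biUnion_finset_le _ _
    _ ≤ ∑ _i ∈ s, ENNReal.ofReal a := Finset.sum_le_sum hB
    _ = ENNReal.ofReal (s.card * a) := by
      rw [Finset.sum_const, nsmul_eq_mul, ENNReal.ofReal_mul (by positivity), ENNReal.ofReal_natCast]

/-- Outside of an event of probability at most `(2 * K * N + 1) * H * exp (-2 * ι)`, the centered
losses of the `N` functions of a finite class concentrate at every step and after every episode, and
so do the sums of the bounded functions `W h`. -/
theorem measure_not_concentrated_le (hfs : ∀ k < K, Measurable[ℱ k] (fs k))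
    (hτ : ∀ k < K, Measurable[ℱ (k + 1)] (τ k))
    (hlaw : ∀ k < K, IsCondLaw Pr (ℱ k) (τ k) (fun ω => trajLaw M (π k ω)))
    (C : Finset (F × (S × Act) × S → EuclideanSpace ℝ (Fin m)))
    (hC : ∀ ψ ∈ C, Measurable ψ) (hR : 0 < R) (hb : ∀ ψ ∈ C, ∀ x, ‖ψ x‖ ≤ R)
    {W : Fin H → F × (S × Act) → ℝ} (hW : ∀ h, Measurable (W h)) (hW0 : ∀ h p, 0 ≤ W h p)
    (hWR : ∀ h p, W h p ≤ R) {ι : ℝ} (hι : 0 < ι) (hK : 0 < K) :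
    Pr {ω | ¬ ((∀ h : Fin H, ∀ ψ ∈ C, ∀ k ≤ K,
          |∑ i ∈ Finset.range k, cross M h ψ (fs i ω) ((τ i ω).1 h) ((τ i ω).next h)|
            ≤ (∑ i ∈ Finset.range k, ‖avg M h ψ (fs i ω) ((τ i ω).1 h)‖ ^ 2) / 4
              + 64 * R ^ 2 * ι) ∧
        ∀ h : Fin H, ∑ i ∈ Finset.range K, (∫ τ', W h (fs i ω, τ'.1 h) ∂trajLaw M (π i ω)
          - W h (fs i ω, (τ i ω).1 h)) ≤ 2 * R * Real.sqrt (ι * K))}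
      ≤ ENNReal.ofReal ((2 * K * C.card + 1) * H * Real.exp (-(2 * ι))) := by
  have hKR : (0 : ℝ) < K := by exact_mod_cast hK
  -- this multiplier balances the two terms `2 * ι / t` and `t * R ^ 2 * K / 2` of the Azuma bound
  set t : ℝ := 2 * Real.sqrt (ι / K) / R with ht
  have ht0 : 0 < t := by positivity
  set B : Fin H × (F × (S × Act) × S → EuclideanSpace ℝ (Fin m)) × ℕ × ℝ → Set Ω := fun q =>
    {ω | 2 * ι ≤ ∑ i ∈ Finset.range (q.2.2.1 + 1),
        (q.2.2.2 / (32 * R ^ 2) * cross M q.1 q.2.1 (fs i ω) ((τ i ω).1 q.1) ((τ i ω).next q.1)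
          - ‖avg M q.1 q.2.1 (fs i ω) ((τ i ω).1 q.1)‖ ^ 2 / (128 * R ^ 2))} with hB
  set B' : Fin H → Set Ω := fun h =>
    {ω | 2 * ι ≤ ∑ i ∈ Finset.range K, (t * (∫ τ', W h (fs i ω, τ'.1 h) ∂trajLaw M (π i ω)
          - W h (fs i ω, (τ i ω).1 h)) - (t * R) ^ 2 / 2)} with hB'
  set s : Finset (Fin H × (F × (S × Act) × S → EuclideanSpace ℝ (Fin m)) × ℕ × ℝ) :=
    Finset.univ ×ˢ (C ×ˢ (Finset.range K ×ˢ {1, -1})) with hs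
  have hscard : (s.card : ℝ) = H * (C.card * (K * 2)) := by
    rw [hs, Finset.card_product, Finset.card_product, Finset.card_product, Finset.card_pair
      (by norm_num)]
    simp
  have h1 := measure_exists_finset_le (Pr := Pr) s (B := B) (a := Real.exp (-(2 * ι))) (by
    rintro ⟨h, ψ, k, σ⟩ hq
    simp only [hs, Finset.mem_product, Finset.mem_univ, true_and, Finset.mem_range,
      Finset.mem_insert, Finset.mem_singleton] at hq
    obtain ⟨hψ, hk, hσ⟩ := hq
    exact measure_le_sum_cross_le_exp hfs hτ hlaw (hC ψ hψ) hR (hb ψ hψ) h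
      (by rcases hσ with rfl | rfl <;> simp) hk (2 * ι))
  have h2 := measure_exists_finset_le (Pr := Pr) Finset.univ (B := B') (a := Real.exp (-(2 * ι)))
    (by
    intro h _
    exact measure_le_sum_integral_traj_sub_le_exp hfs hτ hlaw (hW h) (hW0 h) (hWR h) h ht0.le
      (2 * ι))
  rw [Finset.card_univ, Fintype.card_fin] at h2
  rw [hscard] at h1
  refine le_trans (measure_mono ?_) ((measure_union_le _ _).trans
    ((add_le_add h1 h2).trans (le_of_eq ?_)))
  · intro ω hω
    by_contra hcon
    simp only [Set.mem_union, Set.mem_ofPred_eq, not_or, not_exists, not_and] at hcon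
    obtain ⟨hc1, hc2⟩ := hcon
    refine hω ⟨fun h ψ hψ k hk => ?_, fun h => ?_⟩
    · rcases Nat.eq_zero_or_pos k with rfl | hk0
      · simp; positivity
      obtain ⟨k, rfl⟩ : ∃ j, k = j + 1 := ⟨k - 1, by omega⟩
      have hside : ∀ σ : ℝ, σ = 1 ∨ σ = -1 →
          σ * ∑ i ∈ Finset.range (k + 1), cross M h ψ (fs i ω) ((τ i ω).1 h) ((τ i ω).next h)
            ≤ (∑ i ∈ Finset.range (k + 1), ‖avg M h ψ (fs i ω) ((τ i ω).1 h)‖ ^ 2) / 4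
              + 64 * R ^ 2 * ι := by
        intro σ hσ
        have hmem := hc1 (h, ψ, k, σ) (by
          simp only [hs, Finset.mem_product, Finset.mem_univ, true_and, Finset.mem_range,
            Finset.mem_insert, Finset.mem_singleton]
          exact ⟨hψ, hk, hσ⟩)
        simp only [hB, Set.mem_ofPred_eq, not_le] at hmem
        rw [Finset.sum_sub_distrib, ← Finset.mul_sum, ← Finset.sum_div, sub_lt_iff_lt_add] at hmem
        set X := ∑ i ∈ Finset.range (k + 1), cross M h ψ (fs i ω) ((τ i ω).1 h) ((τ i ω).next h)
        set Y := ∑ i ∈ Finset.range (k + 1), ‖avg M h ψ (fs i ω) ((τ i ω).1 h)‖ ^ 2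
        have h3 := mul_lt_mul_of_pos_right hmem (show 0 < 32 * R ^ 2 by positivity)
        have e1 : σ / (32 * R ^ 2) * X * (32 * R ^ 2) = σ * X := by field_simp
        have e2 : (2 * ι + Y / (128 * R ^ 2)) * (32 * R ^ 2) = Y / 4 + 64 * R ^ 2 * ι := by
          field_simp; ring
        rw [e1, e2] at h3
        exact h3.le
      rw [abs_le]
      have := hside 1 (Or.inl rfl)
      have := hside (-1) (Or.inr rfl)
      constructor <;> linarith
    · have hmem := hc2 h (Finset.mem_univ _)
      simp only [hB', Set.mem_ofPred_eq, not_le] at hmem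
      rw [Finset.sum_sub_distrib, ← Finset.mul_sum, Finset.sum_const, Finset.card_range,
        nsmul_eq_mul, sub_lt_iff_lt_add] at hmem
      set X := ∑ i ∈ Finset.range K, (∫ τ', W h (fs i ω, τ'.1 h) ∂trajLaw M (π i ω)
          - W h (fs i ω, (τ i ω).1 h))
      have e1 : (K : ℝ) * ((t * R) ^ 2 / 2) = 2 * ι := by
        rw [ht, div_mul_cancel₀ _ hR.ne', mul_pow, Real.sq_sqrt (by positivity)]
        field_simp

      have e2 : t * (2 * R * Real.sqrt (ι * K)) = 4 * ι := by
        have : Real.sqrt (ι / K) * Real.sqrt (ι * K) = ι := by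
          rw [← Real.sqrt_mul (by positivity), show ι / K * (ι * K) = ι ^ 2 by field_simp,
            Real.sqrt_sq hι.le]
        rw [ht]
        calc _ = 4 * (Real.sqrt (ι / K) * Real.sqrt (ι * K)) := by field_simp; norm_num
          _ = 4 * ι := by rw [this]
      rw [e1] at hmem
      exact le_of_mul_le_mul_left (by linarith) ht0
  · rw [← ENNReal.ofReal_add (by positivity) (by positivity)]
    congr 1
    ring

end Interaction

/-! ### The algorithm on the event of concentration -/

theorem sub_le_excess {S Act 𝓖 : Type*} {H m : ℕ} {𝓕 : Set 𝓖} (ℓ : Loss S Act H m 𝓕)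
    (fs : ℕ → 𝓕) (τ : ℕ → Traj S Act H) (h : Fin H) (k : ℕ) (f : 𝓕) (g : 𝓖) :
    empLoss ℓ fs τ h k f f - empLoss ℓ fs τ h k f g ≤ excess ℓ fs τ h k f :=
  sub_le_sub_left (ciInf_le
    ⟨0, by rintro _ ⟨g, rfl⟩; exact Finset.sum_nonneg fun _ _ => by positivity⟩ g) _

section Run

variable {S Act : Type*} [MeasurableSpace S] [MeasurableSpace Act] {H m K : ℕ}
  {𝓖 : Type*} {𝓕 : Set 𝓖} {M : Model S Act H} {ℓ : Loss S Act H m 𝓕} {V₁ : 𝓕 → ℝ} {β : ℝ}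
  {fs : ℕ → 𝓕} {conf : ℕ → Set 𝓕} {τ : ℕ → Traj S Act H} {fstar : 𝓕} {T : 𝓕 → 𝓖}

/-- The loss of the pair `(f, g)` at step `h`, as a member of the loss class. -/
def lossFun (ℓ : Loss S Act H m 𝓕) (h : Fin H) (f : 𝓕) (g : 𝓖) :
    𝓕 × (S × Act) × S → EuclideanSpace ℝ (Fin m) :=
  fun x => ℓ h x.1 x.2.1 x.2.2 f g

/-- The sum over the first `k` episodes of the squared mean losses of `f`. -/
noncomputable def sumSq (M : Model S Act H) (ℓ : Loss S Act H m 𝓕) (fs : ℕ → 𝓕)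
    (τ : ℕ → Traj S Act H) (h : Fin H) (k : ℕ) (f : 𝓕) (g : 𝓖) : ℝ :=
  ∑ i ∈ Finset.range k, ‖meanLoss M ℓ h (fs i) ((τ i).1 h) f g‖ ^ 2

/-- The sum over the first `k` episodes of the squared mean losses of the selected hypotheses. -/
noncomputable def diagSumSq (M : Model S Act H) (ℓ : Loss S Act H m 𝓕) (fs : ℕ → 𝓕)
    (τ : ℕ → Traj S Act H) (h : Fin H) (k : ℕ) : ℝ :=
  ∑ i ∈ Finset.range k, ‖meanLoss M ℓ h (fs i) ((τ i).1 h) (fs i) (fs i)‖ ^ 2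

/-- Uniform concentration of the centered losses, with precision `β / 20`. -/
def Concentrated (M : Model S Act H) (ℓ : Loss S Act H m 𝓕) (β : ℝ) (K : ℕ) (fs : ℕ → 𝓕)
    (τ : ℕ → Traj S Act H) : Prop :=
  ∀ (h : Fin H) (f : 𝓕) (g : 𝓖), ∀ k ≤ K,
    |∑ i ∈ Finset.range k, cross M h (lossFun ℓ h f g) (fs i) ((τ i).1 h) ((τ i).next h)|
      ≤ sumSq M ℓ fs τ h k f g / 4 + β / 20

theorem sumSq_nonneg (h : Fin H) (k : ℕ) (f : 𝓕) (g : 𝓖) : 0 ≤ sumSq M ℓ fs τ h k f g :=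
  Finset.sum_nonneg fun _ _ => by positivity

theorem empLoss_sub_empLoss_operator
    (hT : ∀ (h : Fin H) (f' f : 𝓕) (g : 𝓖) (η : S × Act) (ζ : S),
      ℓ h f' η ζ f g - meanLoss M ℓ h f' η f g = ℓ h f' η ζ f (T f))
    (h : Fin H) (k : ℕ) (f : 𝓕) (g : 𝓖) :
    empLoss ℓ fs τ h k f g - empLoss ℓ fs τ h k f (T f) = sumSq M ℓ fs τ h k f g
      + ∑ i ∈ Finset.range k, cross M h (lossFun ℓ h f g) (fs i) ((τ i).1 h) ((τ i).next h) := by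
  unfold empLoss sumSq
  rw [← Finset.sum_sub_distrib, ← Finset.sum_add_distrib]
  refine Finset.sum_congr rfl fun i _ => ?_
  rw [← hT h (fs i) f g]
  exact normSq_sub_normSq_sub_avg M h (lossFun ℓ h f g) (fs i) ((τ i).1 h) ((τ i).next h)

section Conc

variable (hT : ∀ (h : Fin H) (f' f : 𝓕) (g : 𝓖) (η : S × Act) (ζ : S),
      ℓ h f' η ζ f g - meanLoss M ℓ h f' η f g = ℓ h f' η ζ f (T f))
  (hconc : Concentrated M ℓ β K fs τ)

include hT hconc

theorem Concentrated.excess_le_sub_add (h : Fin H) {k : ℕ} (hk : k ≤ K) (f : 𝓕) :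
    excess ℓ fs τ h k f
      ≤ empLoss ℓ fs τ h k f f - empLoss ℓ fs τ h k f (T f) + β / 20 := by
  have : Nonempty 𝓖 := ⟨f⟩
  have hinf : empLoss ℓ fs τ h k f (T f) - β / 20 ≤ ⨅ g : 𝓖, empLoss ℓ fs τ h k f g := by
    refine le_ciInf fun g => ?_
    have h1 := empLoss_sub_empLoss_operator (fs := fs) (τ := τ) hT h k f g
    have h2 := (abs_le.1 (hconc h f g k hk)).1
    have h3 := sumSq_nonneg (M := M) (ℓ := ℓ) (fs := fs) (τ := τ) h k f g
    linarith
  unfold excess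
  linarith

theorem Concentrated.sumSq_le (h : Fin H) {k : ℕ} (hk : k ≤ K) (f : 𝓕) :
    sumSq M ℓ fs τ h k f f ≤ 4 / 3 * (excess ℓ fs τ h k f + β / 20) := by
  have h1 := empLoss_sub_empLoss_operator (fs := fs) (τ := τ) hT h k f f
  have h2 := (abs_le.1 (hconc h f f k hk)).1
  have h3 := sub_le_excess ℓ fs τ h k f (T f)
  linarith

theorem Concentrated.excess_le (h : Fin H) {k : ℕ} (hk : k ≤ K) (f : 𝓕) :
    excess ℓ fs τ h k f ≤ 5 / 4 * sumSq M ℓ fs τ h k f f + β / 10 := by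
  have h1 := empLoss_sub_empLoss_operator (fs := fs) (τ := τ) hT h k f f
  have h2 := (abs_le.1 (hconc h f f k hk)).2
  have h3 := hconc.excess_le_sub_add hT h hk f
  linarith

variable (hstar : T fstar = fstar) (hβ : 0 < β) (hrun : IsRun ℓ V₁ β K fs conf τ)

include hstar hβ hrun

theorem IsRun.fstar_mem_conf {k : ℕ} (hk : k ≤ K) : fstar ∈ conf k := by
  induction k with
  | zero => rw [hrun.init]; trivial
  | succ k ih =>
    by_cases hu : ∃ h, 5 * β ≤ excess ℓ fs τ h (k + 1) (fs k)
    · rw [hrun.update k hk hu]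
      intro h
      have := hconc.excess_le_sub_add hT h hk fstar
      rw [hstar, sub_self] at this
      linarith
    · rw [(hrun.keep k hk hu).1]
      exact ih (by omega)

theorem IsRun.optimism {k : ℕ} (hk : k ≤ K) : V₁ fstar ≤ V₁ (fs k) := by
  have hmem := hrun.fstar_mem_conf hT hconc hstar hβ hk
  exact (hrun.select k hk ⟨_, hmem⟩).2 _ hmem

theorem IsRun.excess_le_of_update {k : ℕ} (hk : k < K)
    (hu : ∃ h, 5 * β ≤ excess ℓ fs τ h (k + 1) (fs k)) (h : Fin H) :
    excess ℓ fs τ h (k + 1) (fs (k + 1)) ≤ β := by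
  have hmem := hrun.fstar_mem_conf hT hconc hstar hβ (k := k + 1) hk
  have := (hrun.select (k + 1) hk ⟨_, hmem⟩).1
  rw [hrun.update k hk hu] at this
  exact this h

theorem IsRun.sumSq_le {k : ℕ} (hk : k ≤ K) (h : Fin H) :
    sumSq M ℓ fs τ h k (fs k) (fs k) ≤ 7 * β := by
  rcases k with _ | k
  · simp [sumSq]; linarith
  have hex : excess ℓ fs τ h (k + 1) (fs (k + 1)) ≤ 5 * β := by
    by_cases hu : ∃ h, 5 * β ≤ excess ℓ fs τ h (k + 1) (fs k)
    · linarith [hrun.excess_le_of_update hT hconc hstar hβ hk hu h]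
    · rw [(hrun.keep k hk hu).2]
      push Not at hu
      exact (hu h).le
  linarith [hconc.sumSq_le hT h hk (fs (k + 1))]

open Classical in
/-- Each update that is triggered at step `h` adds at least `β` to the sum of the squared mean losses
of the selected hypotheses. The time `t` is the one of the last update: from then on the selected
hypothesis is constant, so that the loss it accumulates is counted by `diagSumSq`. -/
theorem IsRun.exists_last_update {k : ℕ} (hk : k ≤ K) : ∃ t ≤ k,
    (∀ i, t ≤ i → i ≤ k → fs i = fs k) ∧
    (∀ h, sumSq M ℓ fs τ h t (fs k) (fs k) ≤ 7 / 5 * β) ∧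
    ∀ h, (((Finset.range k).filter fun j => 5 * β ≤ excess ℓ fs τ h (j + 1) (fs j)).card : ℝ) * β
      ≤ diagSumSq M ℓ fs τ h t := by
  induction k with
  | zero =>
    refine ⟨0, le_rfl, fun i _ hi => by rw [Nat.le_zero.1 hi], fun h => ?_, fun h => ?_⟩
    · simp [sumSq]; linarith
    · simp [diagSumSq]
  | succ k ih =>
    obtain ⟨t, htk, hconst, hsum, hcount⟩ := ih (by omega)
    have hkK : k < K := hk
    by_cases hu : ∃ h, 5 * β ≤ excess ℓ fs τ h (k + 1) (fs k)
    · refine ⟨k + 1, le_rfl, fun i h1 h2 => by rw [le_antisymm h2 h1], fun h => ?_, fun h => ?_⟩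
      · have h1 := hrun.excess_le_of_update hT hconc hstar hβ hkK hu h
        have h2 := hconc.sumSq_le hT h hk (fs (k + 1))
        linarith
      · have hsplit : diagSumSq M ℓ fs τ h (k + 1) = diagSumSq M ℓ fs τ h t
            + ∑ i ∈ Finset.Ico t (k + 1),
              ‖meanLoss M ℓ h (fs i) ((τ i).1 h) (fs i) (fs i)‖ ^ 2 := by
          unfold diagSumSq
          rw [Finset.sum_range_add_sum_Ico _ (by omega)]
        have hsplit' : sumSq M ℓ fs τ h (k + 1) (fs k) (fs k) = sumSq M ℓ fs τ h t (fs k) (fs k)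
            + ∑ i ∈ Finset.Ico t (k + 1),
              ‖meanLoss M ℓ h (fs i) ((τ i).1 h) (fs k) (fs k)‖ ^ 2 := by
          unfold sumSq
          rw [Finset.sum_range_add_sum_Ico _ (by omega)]
        have hIco : ∑ i ∈ Finset.Ico t (k + 1),
              ‖meanLoss M ℓ h (fs i) ((τ i).1 h) (fs i) (fs i)‖ ^ 2
            = ∑ i ∈ Finset.Ico t (k + 1),
              ‖meanLoss M ℓ h (fs i) ((τ i).1 h) (fs k) (fs k)‖ ^ 2 := by
          refine Finset.sum_congr rfl fun i hi => ?_
          rw [Finset.mem_Ico] at hi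
          rw [hconst i hi.1 (by omega)]
        have hIco0 : 0 ≤ ∑ i ∈ Finset.Ico t (k + 1),
              ‖meanLoss M ℓ h (fs i) ((τ i).1 h) (fs k) (fs k)‖ ^ 2 :=
          Finset.sum_nonneg fun _ _ => by positivity
        rw [Finset.range_add_one, Finset.filter_insert]
        split_ifs with htrig
        · rw [Finset.card_insert_of_notMem (by simp)]
          push_cast
          have h1 := hconc.excess_le hT h hk (fs k)
          linarith [hcount h, hsum h]
        · linarith [hcount h]
    · have hkeep := (hrun.keep k hkK hu).2
      refine ⟨t, by omega, fun i h1 h2 => ?_, fun h => ?_, fun h => ?_⟩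
      · rcases Nat.lt_or_ge i (k + 1) with h3 | h3
        · rw [hconst i h1 (by omega), hkeep]
        · rw [le_antisymm h2 h3]
      · rw [hkeep]; exact hsum h
      · push Not at hu
        rw [Finset.range_add_one, Finset.filter_insert, if_neg (not_le.2 (hu h))]
        exact hcount h

open Classical in
theorem IsRun.card_switch_mul_le :
    (((Finset.range K).filter fun k => fs (k + 1) ≠ fs k).card : ℝ) * β
      ≤ ∑ h, diagSumSq M ℓ fs τ h K := by
  obtain ⟨t, ht, -, -, hcount⟩ := hrun.exists_last_update hT hconc hstar hβ le_rfl
  have hsub : ((Finset.range K).filter fun k => fs (k + 1) ≠ fs k) ⊆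
      Finset.univ.biUnion fun h : Fin H =>
        (Finset.range K).filter fun j => 5 * β ≤ excess ℓ fs τ h (j + 1) (fs j) := by
    intro k hk
    rw [Finset.mem_filter, Finset.mem_range] at hk
    by_contra hcon
    refine hk.2 (hrun.keep k hk.1 ?_).2
    rintro ⟨h, hh⟩
    refine hcon (Finset.mem_biUnion.2 ⟨h, Finset.mem_univ _, ?_⟩)
    exact Finset.mem_filter.2 ⟨Finset.mem_range.2 hk.1, hh⟩
  have hcard := (Finset.card_le_card hsub).trans Finset.card_biUnion_le
  have hcard' : (((Finset.range K).filter fun k => fs (k + 1) ≠ fs k).card : ℝ) ≤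
      ∑ h : Fin H, (((Finset.range K).filter fun j =>
        5 * β ≤ excess ℓ fs τ h (j + 1) (fs j)).card : ℝ) := by exact_mod_cast hcard
  calc _ ≤ (∑ h : Fin H, (((Finset.range K).filter fun j =>
        5 * β ≤ excess ℓ fs τ h (j + 1) (fs j)).card : ℝ)) * β :=
        mul_le_mul_of_nonneg_right hcard' hβ.le
    _ ≤ ∑ h, diagSumSq M ℓ fs τ h K := by
        rw [Finset.sum_mul]
        refine Finset.sum_le_sum fun h _ => (hcount h).trans ?_
        exact Finset.sum_le_sum_of_subset_of_nonneg (Finset.range_subset_range.2 ht)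
          fun _ _ _ => by positivity

end Conc

end Run

/-! ### Consequences of the eluder condition -/

section Eluder

variable {S Act : Type*} [MeasurableSpace S] [MeasurableSpace Act] {H m K : ℕ}
  {𝓖 : Type*} {𝓕 : Set 𝓖} {M : Model S Act H} {ℓ : Loss S Act H m 𝓕} {V₁ : 𝓕 → ℝ}
  {Exec : 𝓕 → Set (Policy S Act)} {R Ce d κ : ℝ}

/-- If `Ce * d * log K < 1`, then all mean losses are small: the eluder condition is applied to
constant sequences. This replaces a lower bound on `d` in the regret bound. -/
theorem IsEllTwoEC.mul_normSq_meanLoss_le (hec : IsEllTwoEC M ℓ V₁ Exec K R Ce d κ) (hK : 2 ≤ K)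
    (hsmall : Ce * d * Real.log K < 1) (h : Fin H) (f : 𝓕) (η : S × Act) :
    K * ‖meanLoss M ℓ h f η f f‖ ^ 2 ≤ Ce * d * R ^ 2 * Real.log K := by
  set y := ‖meanLoss M ℓ h f η f f‖ with hy
  have hK' : (2 : ℝ) ≤ K := by exact_mod_cast hK
  have hel := fun β hβ hle =>
    hec.eluder β hβ h (fun _ => f) (fun _ => η) hle K hK le_rfl
  simp only [Finset.sum_const, Finset.card_range, nsmul_eq_mul, ← hy] at hel
  have hle : ∀ β, (K - 1) * y ^ 2 ≤ β → ∀ k < K, (k : ℝ) * y ^ 2 ≤ β := fun β hβ k hk => by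
    have : (k : ℝ) ≤ K - 1 := by
      have : ((k + 1 : ℕ) : ℝ) ≤ K := by exact_mod_cast hk
      push_cast at this
      linarith
    exact (mul_le_mul_of_nonneg_right this (sq_nonneg y)).trans hβ
  rcases le_total ((K - 1) * y ^ 2) (R ^ 2) with h1 | h1
  · have := hel (R ^ 2) le_rfl (hle _ h1)
    linarith
  · -- a loss this large would violate the eluder condition with `β = (K - 1) * y ^ 2`, unless `y = 0`
    have h2 := hel _ h1 (hle _ le_rfl)
    have h3 : Ce * d * Real.log K * ((K - 1) * y ^ 2) ≤ 1 * ((K - 1) * y ^ 2) :=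
      mul_le_mul_of_nonneg_right hsmall.le (mul_nonneg (by linarith) (sq_nonneg y))
    have hy0 : y ^ 2 = 0 := by nlinarith [sq_nonneg y]
    have hR0 : R ^ 2 = 0 := by
      rw [hy0, mul_zero] at h1
      exact le_antisymm h1 (sq_nonneg R)
    rw [hy0, hR0]
    simp

/-- The expected norms of the mean losses, from their concentration and from the bound on the
realized squared norms. -/
theorem IsEllTwoEC.sum_integral_le (hec : IsEllTwoEC M ℓ V₁ Exec K R Ce d κ) (hK : 2 ≤ K)
    (hR : 0 < R) (hCe : 0 < Ce) (hd : 0 ≤ d) {β ι : ℝ} (hι : 0 < ι) (hRβ : R ^ 2 ≤ β)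
    (hιβ : R ^ 2 * ι ≤ β) {fs : ℕ → 𝓕} {π : ℕ → Policy S Act} {τ : ℕ → Traj S Act H} (h : Fin H)
    (hdiag : diagSumSq M ℓ fs τ h K ≤ Ce * (d * (7 * β) * Real.log K))
    (hdev : ∑ i ∈ Finset.range K, (∫ τ', ‖meanLoss M ℓ h (fs i) (τ'.1 h) (fs i) (fs i)‖
        ∂trajLaw M (π i) - ‖meanLoss M ℓ h (fs i) ((τ i).1 h) (fs i) (fs i)‖)
      ≤ 2 * R * Real.sqrt (ι * K)) :
    ∑ i ∈ Finset.range K,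
        ∫ τ', ‖meanLoss M ℓ h (fs i) (τ'.1 h) (fs i) (fs i)‖ ∂trajLaw M (π i)
      ≤ 10 * Real.sqrt Ce * (Real.sqrt (d * β * K) * Real.log K) := by
  have hK' : (2 : ℝ) ≤ K := by exact_mod_cast hK
  have hK0 : (0 : ℝ) < K := by linarith
  have hL : 1 / 2 < Real.log K :=
    lt_of_lt_of_le (by linarith [Real.log_two_gt_d9]) (Real.log_le_log two_pos hK')
  have hL0 : 0 < Real.log K := by linarith
  have hβ : 0 < β := lt_of_lt_of_le (by positivity) hRβ
  set Z := Real.sqrt (Ce * (d * β * K) * Real.log K) with hZ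
  have hZ0 : 0 ≤ Z := Real.sqrt_nonneg _
  have hZsq : Z ^ 2 = Ce * (d * β * K) * Real.log K := Real.sq_sqrt (by positivity)
  have hZle : Z ≤ 2 * Real.sqrt Ce * (Real.sqrt (d * β * K) * Real.log K) := by
    have hsq : Real.sqrt (Real.log K) ≤ 2 * Real.log K := by
      rw [Real.sqrt_le_left (by positivity)]
      nlinarith
    rw [hZ, Real.sqrt_mul (by positivity), Real.sqrt_mul hCe.le]
    calc _ ≤ Real.sqrt Ce * Real.sqrt (d * β * K) * (2 * Real.log K) := by gcongr
      _ = _ := by ring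
  suffices hmain : ∑ i ∈ Finset.range K,
      ∫ τ', ‖meanLoss M ℓ h (fs i) (τ'.1 h) (fs i) (fs i)‖ ∂trajLaw M (π i) ≤ 5 * Z by linarith
  rcases le_or_gt 1 (Ce * d * Real.log K) with hbig | hsmall
  · set w : ℕ → ℝ := fun i => ‖meanLoss M ℓ h (fs i) ((τ i).1 h) (fs i) (fs i)‖ with hw
    rw [Finset.sum_sub_distrib] at hdev
    have h1 : ∑ i ∈ Finset.range K, w i ≤ 3 * Z := by
      have hcs := sq_sum_le_card_mul_sum_sq (s := Finset.range K) (f := w)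
      rw [Finset.card_range] at hcs
      have : (∑ i ∈ Finset.range K, w i) ^ 2 ≤ (3 * Z) ^ 2 := by
        calc _ ≤ (K : ℝ) * (Ce * (d * (7 * β) * Real.log K)) :=
              hcs.trans (mul_le_mul_of_nonneg_left hdiag hK0.le)
          _ = 7 * Z ^ 2 := by rw [hZsq]; ring
          _ ≤ (3 * Z) ^ 2 := by nlinarith [sq_nonneg Z]
      exact le_of_sq_le_sq this (by positivity)
    have h2 : R * Real.sqrt (ι * K) ≤ Z := by
      refine le_of_sq_le_sq ?_ hZ0
      rw [mul_pow, Real.sq_sqrt (by positivity), hZsq]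
      calc R ^ 2 * (ι * K) = R ^ 2 * ι * K * 1 := by ring
        _ ≤ β * K * (Ce * d * Real.log K) := by gcongr
        _ = _ := by ring
    linarith
  · have hpt : ∀ (f : 𝓕) (η : S × Act), ‖meanLoss M ℓ h f η f f‖ ≤ Z / K := by
      intro f η
      rw [le_div_iff₀ hK0]
      refine le_of_sq_le_sq ?_ hZ0
      have h1 := hec.mul_normSq_meanLoss_le hK hsmall h f η
      have h2 : Ce * d * R ^ 2 * Real.log K ≤ Ce * d * β * Real.log K := by gcongr
      calc _ = K * (K * ‖meanLoss M ℓ h f η f f‖ ^ 2) := by ring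
        _ ≤ K * (Ce * d * β * Real.log K) := mul_le_mul_of_nonneg_left (h1.trans h2) hK0.le
        _ = Z ^ 2 := by rw [hZsq]; ring
    calc _ ≤ ∑ _i ∈ Finset.range K, Z / K := by
          refine Finset.sum_le_sum fun i _ => ?_
          refine (Real.le_norm_self _).trans ((norm_integral_le_of_norm_le_const (C := Z / K)
            (.of_forall fun τ' => ?_)).trans ?_)
          · rw [norm_norm]; exact hpt _ _
          · simp
      _ = Z := by
          rw [Finset.sum_const, Finset.card_range, nsmul_eq_mul]
          field_simp
      _ ≤ 5 * Z := by linarith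

end Eluder

/-! ### The bounds on the regret and on the number of switches -/

section Main

variable {S Act 𝓖 Ω : Type*} [MeasurableSpace S] [MeasurableSpace Act] [MeasurableSpace 𝓖]
  {mΩ : MeasurableSpace Ω} {H m K : ℕ} {𝓕 : Set 𝓖} {M : Model S Act H} {fstar : 𝓕}
  {ℓ : Loss S Act H m 𝓕} {V₁ : 𝓕 → ℝ} {Exec : 𝓕 → Set (Policy S Act)} {R Ce d κ δ β : ℝ}
  {Pr : Measure Ω} [IsProbabilityMeasure Pr] {ℱ : Filtration ℕ mΩ} {fs : ℕ → Ω → 𝓕}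
  {conf : ℕ → Ω → Set 𝓕} {π : ℕ → Ω → Policy S Act} {τ : ℕ → Ω → Traj S Act H}

/-- Concentration passes from a cover of the loss class to the whole class; the error is of order
`R` over `K` episodes and is absorbed by `β`. -/
theorem concentrated_of_cover {fs : ℕ → 𝓕} {τ : ℕ → Traj S Act H} (hK : 2 ≤ K)
    (hmeas : MeasurableLoss ℓ) (hR : 0 < R)
    (hb : ∀ (h : Fin H) (f' : 𝓕) (η : S × Act) (ζ : S) (f : 𝓕) (g : 𝓖), ‖ℓ h f' η ζ f g‖ ≤ R)
    {C : Finset (𝓕 × (S × Act) × S → EuclideanSpace ℝ (Fin m))}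
    (hC : IsSupCover (lossClass ℓ) (1 / (K : ℝ)) C) {ι : ℝ}
    (hβ : 1280 * (R ^ 2 * ι + R) ≤ β)
    (hcov : ∀ h : Fin H, ∀ ψ ∈ C, ∀ k ≤ K,
      |∑ i ∈ Finset.range k, cross M h ψ (fs i) ((τ i).1 h) ((τ i).next h)|
        ≤ (∑ i ∈ Finset.range k, ‖avg M h ψ (fs i) ((τ i).1 h)‖ ^ 2) / 4 + 64 * R ^ 2 * ι) :
    Concentrated M ℓ β K fs τ := by
  intro h f g k hk
  have hK0 : (0 : ℝ) < K := by exact_mod_cast (by omega : 0 < K)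
  obtain ⟨ψ, hψC, hψ⟩ := hC.2 (lossFun ℓ h f g) ⟨h, f, g, rfl⟩
  obtain ⟨h', f', g', hψ'⟩ := hC.1 hψC
  have hmφ : Measurable (lossFun ℓ h f g) := hmeas.fixed h f g
  have hmψ : Measurable ψ := hψ' ▸ hmeas.fixed h' f' g'
  have hbφ : ∀ x, ‖lossFun ℓ h f g x‖ ≤ R := fun x => hb _ _ _ _ _ _
  have hbψ : ∀ x, ‖ψ x‖ ≤ R := fun x => by rw [hψ']; exact hb _ _ _ _ _ _
  have hkK : (k : ℝ) * (1 / K) ≤ 1 := by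
    rw [mul_one_div, div_le_one hK0]
    exact_mod_cast hk
  have h1 : |∑ i ∈ Finset.range k,
        cross M h (lossFun ℓ h f g) (fs i) ((τ i).1 h) ((τ i).next h)
      - ∑ i ∈ Finset.range k, cross M h ψ (fs i) ((τ i).1 h) ((τ i).next h)| ≤ 8 * R := by
    rw [← Finset.sum_sub_distrib]
    calc _ ≤ ∑ _i ∈ Finset.range k, 8 * R * (1 / K) := (Finset.abs_sum_le_sum_abs _ _).trans
          (Finset.sum_le_sum fun i _ => abs_cross_sub_le hmφ hbφ hmψ hbψ hψ _ _ _)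
      _ = 8 * R * (k * (1 / K)) := by simp; ring
      _ ≤ 8 * R * 1 := by gcongr
      _ = 8 * R := mul_one _
  have h2 : |sumSq M ℓ fs τ h k f g
      - ∑ i ∈ Finset.range k, ‖avg M h ψ (fs i) ((τ i).1 h)‖ ^ 2| ≤ 2 * R := by
    have : sumSq M ℓ fs τ h k f g
        = ∑ i ∈ Finset.range k, ‖avg M h (lossFun ℓ h f g) (fs i) ((τ i).1 h)‖ ^ 2 := rfl
    rw [this, ← Finset.sum_sub_distrib]
    calc _ ≤ ∑ _i ∈ Finset.range k, 2 * R * (1 / K) := (Finset.abs_sum_le_sum_abs _ _).trans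
          (Finset.sum_le_sum fun i _ => abs_normSq_avg_sub_le hmφ hbφ hmψ hbψ hψ _ _)
      _ = 2 * R * (k * (1 / K)) := by simp; ring
      _ ≤ 2 * R * 1 := by gcongr
      _ = 2 * R := mul_one _
  have h3 := hcov h ψ hψC k hk
  rw [abs_le] at h1 h2 h3 ⊢
  constructor <;> linarith

theorem exists_card_eq_coveringNumber {X E : Type*} [NormedAddCommGroup E] {L : Set (X → E)} {ρ : ℝ}
    (h : ∃ D, IsSupCover L ρ D) : ∃ D, IsSupCover L ρ D ∧ D.card = coveringNumber L ρ := by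
  obtain ⟨D, hD⟩ := h
  exact Nat.sInf_mem (s := {t | ∃ C : Finset (X → E), IsSupCover L ρ C ∧ C.card = t}) ⟨_, D, hD, rfl⟩

/-- The union bound: the failure probabilities of all events add up to at most `δ`. -/
theorem union_bound_le {H K N δ ι : ℝ} (hH : 1 ≤ H) (hK : 2 ≤ K) (hN : 1 ≤ N) (hδ : 0 < δ)
    (hδ1 : δ < 1) (hι : ι = Real.log (H * K ^ 2 * N / δ)) :
    (2 * K * N + 1) * H * Real.exp (-(2 * ι)) ≤ δ := by
  have hpos : 0 < H * K ^ 2 * N / δ := by positivity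
  have hexp : Real.exp (-(2 * ι)) = (δ / (H * K ^ 2 * N)) ^ 2 := by
    rw [show -(2 * ι) = -ι + -ι by ring, Real.exp_add, Real.exp_neg, hι, Real.exp_log hpos, inv_div]
    ring
  rw [hexp, div_pow, ← mul_div_assoc, div_le_iff₀ (by positivity)]
  have h1 : 2 * K * N + 1 ≤ (H * K ^ 2 * N) * (K ^ 2 * N) := by
    have hKN : 2 ≤ K * N := by nlinarith
    have hK2 : 4 ≤ K ^ 2 := by nlinarith
    have ha : 2 * (K * N) ≤ K ^ 2 * N := by
      rw [sq, mul_assoc]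
      exact mul_le_mul_of_nonneg_right hK (by linarith)
    have hb : K ^ 2 * N ≤ H * K ^ 2 * N := by
      rw [mul_assoc H]
      exact le_mul_of_one_le_left (by positivity) hH
    nlinarith
  have h2 : δ ^ 2 ≤ δ := by nlinarith
  calc (2 * K * N + 1) * H * δ ^ 2 ≤ ((H * K ^ 2 * N) * (K ^ 2 * N)) * H * δ := by gcongr
    _ = δ * (H * K ^ 2 * N) ^ 2 := by ring

open Classical in
/-- The common form of both parts of the theorem. The policies that may be executed are described by
`Exec`, and switches are counted between hypotheses. -/
theorem measure_not_regret_and_switch_le {c : ℝ} (hc : 1280 ≤ c) (hCe : 0 < Ce) (hH : 1 ≤ H)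
    (hK : 2 ≤ K) (hR : 0 < R) (hd : 0 ≤ d) (hκ : 0 ≤ κ) (hδ : 0 < δ) (hδ1 : δ < 1)
    (hmeas : MeasurableLoss ℓ) (hec : IsEllTwoEC M ℓ V₁ Exec K R Ce d κ)
    (hdec : IsDecomposable M ℓ fstar) (hcover : ∃ D, IsSupCover (lossClass ℓ) (1 / (K : ℝ)) D)
    (hβ : β = c * (R ^ 2 * Real.log
      (H * (K : ℝ) ^ 2 * coveringNumber (lossClass ℓ) (1 / (K : ℝ)) / δ) + R))
    (hint : IsInteraction Pr ℱ M ℓ V₁ β K fs conf π τ) (hπ : ∀ k ω, π k ω ∈ Exec (fs k ω)) :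
    Pr {ω | ¬ (regret M (V₁ fstar) (fun k => π k ω) K
          ≤ 10 * Real.sqrt Ce * (κ * H * Real.sqrt (d * β * K) * Real.log K) ∧
        (((Finset.range K).filter fun k => fs (k + 1) ω ≠ fs k ω).card : ℝ)
          ≤ 7 * Ce * (d * H * Real.log K))} ≤ ENNReal.ofReal δ := by
  obtain ⟨C, hC, hCcard⟩ := exists_card_eq_coveringNumber hcover
  rw [← hCcard] at hβ
  obtain ⟨T, hTstar, hT⟩ := hdec
  have hH' : (1 : ℝ) ≤ H := by exact_mod_cast hH
  have hK' : (2 : ℝ) ≤ K := by exact_mod_cast hK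
  have hN : (1 : ℝ) ≤ C.card := by
    obtain ⟨ψ, hψ, -⟩ := hC.2 (lossFun ℓ ⟨0, hH⟩ fstar fstar) ⟨_, _, _, rfl⟩
    exact_mod_cast Finset.card_pos.2 ⟨ψ, hψ⟩
  set ι := Real.log (H * (K : ℝ) ^ 2 * C.card / δ) with hι
  have hι1 : 1 ≤ ι := by
    have h4 : (4 : ℝ) ≤ H * (K : ℝ) ^ 2 * C.card / δ := by
      rw [le_div_iff₀ hδ]
      have : (4 : ℝ) ≤ H * (K : ℝ) ^ 2 * C.card := by
        calc (4 : ℝ) = 1 * 2 ^ 2 * 1 := by norm_num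
          _ ≤ _ := by gcongr
      linarith
    have hlog4 : (1 : ℝ) ≤ Real.log 4 := by
      rw [show (4 : ℝ) = 2 ^ 2 by norm_num, Real.log_pow]
      push_cast
      linarith [Real.log_two_gt_d9]
    exact hlog4.trans (Real.log_le_log (by norm_num) h4)
  have hR2 : 0 < R ^ 2 := by positivity
  have hβ1 : 1280 * (R ^ 2 * ι + R) ≤ β := by rw [hβ]; gcongr
  have hRι : R ^ 2 ≤ R ^ 2 * ι := le_mul_of_one_le_right hR2.le hι1
  have hιβ : R ^ 2 * ι ≤ β := by linarith
  have hβ0 : 0 < β := by linarith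
  have hmW : ∀ h : Fin H, Measurable fun p : 𝓕 × (S × Act) => ‖meanLoss M ℓ h p.1 p.2 p.1 p.1‖ :=
    fun h => (measurable_avg (M := M) (h := h)
      (φ := fun x : 𝓕 × (S × Act) × S => ℓ h x.1 x.2.1 x.2.2 x.1 x.1) (hmeas.diag h)).norm
  have hmain := measure_not_concentrated_le (m := m) hint.measurable_fs hint.measurable_traj
    (fun k hk => hint.law k hk) C
    (fun ψ hψ => by obtain ⟨h, f, g, rfl⟩ := hC.1 hψ; exact hmeas.fixed h f g) hR
    (fun ψ hψ x => by obtain ⟨h, f, g, rfl⟩ := hC.1 hψ; exact hec.bounded _ _ _ _ _ _)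
    (W := fun h p => ‖meanLoss M ℓ h p.1 p.2 p.1 p.1‖) hmW (fun _ _ => norm_nonneg _)
    (fun h p => norm_avg_le (M := M) (h := h)
      (φ := fun x : 𝓕 × (S × Act) × S => ℓ h x.1 x.2.1 x.2.2 x.1 x.1)
      (fun x => hec.bounded _ _ _ _ _ _) p.1 p.2)
    (ι := ι) (by linarith) (by omega)
  refine le_trans (measure_mono_ae ?_) (hmain.trans (ENNReal.ofReal_le_ofReal
    (union_bound_le hH' hK' hN hδ hδ1 hι)))
  filter_upwards [hint.run] with ω hrun hbad hgood
  refine hbad ?_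
  obtain ⟨hcov, hdev⟩ := hgood
  have hconc := concentrated_of_cover hK hmeas hR hec.bounded hC hβ1 hcov
  have hdiag : ∀ h, diagSumSq M ℓ (fun k => fs k ω) (fun k => τ k ω) h K
      ≤ Ce * (d * (7 * β) * Real.log K) := fun h =>
    hec.eluder (7 * β) (by linarith) h (fun k => fs k ω) (fun k => (τ k ω).1 h)
      (fun k hk => hrun.sumSq_le hT hconc hTstar hβ0 hk.le h) K hK le_rfl
  constructor
  · have hopt : regret M (V₁ fstar) (fun k => π k ω) K
        ≤ ∑ k ∈ Finset.range K, (V₁ (fs k ω) - value M (π k ω) 0 M.s₁) :=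
      Finset.sum_le_sum fun k hk => sub_le_sub_right
        (hrun.optimism hT hconc hTstar hβ0 (Finset.mem_range.1 hk).le) _
    have hdom := hec.dominance (fun k => fs k ω) (fun k => π k ω) (fun k => hπ k ω) K le_rfl
    refine hopt.trans (hdom.trans ?_)
    calc _ ≤ κ * ∑ _h : Fin H, 10 * Real.sqrt Ce * (Real.sqrt (d * β * K) * Real.log K) := by
          gcongr with h
          exact hec.sum_integral_le hK hR hCe hd (by linarith) (by linarith) hιβ h (hdiag h)
            (hdev h)
      _ = _ := by simp; ring
  · have hcard := hrun.card_switch_mul_le hT hconc hTstar hβ0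
    refine le_of_mul_le_mul_right (hcard.trans ?_) hβ0
    calc _ ≤ ∑ _h : Fin H, Ce * (d * (7 * β) * Real.log K) := Finset.sum_le_sum fun h _ => hdiag h
      _ = _ := by simp; ring

theorem switchCost_le_card_ne {X S A : Type*} [MeasurableSpace S] [MeasurableSpace A]
    (H : ℕ) (pol : X → Policy S A) (x : ℕ → X) (K : ℕ)
    {_ : DecidablePred fun k => x (k + 1) ≠ x k} :
    switchCost H (fun k => pol (x k)) K ≤ ((Finset.range K).filter fun k => x (k + 1) ≠ x k).card := by
  classical
  unfold switchCost
  refine Finset.card_le_card fun k hk => ?_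
  rw [Finset.mem_filter] at hk ⊢
  refine ⟨hk.1, fun heq => hk.2 ?_⟩
  simp only [heq]
  exact fun _ _ => rfl

end Main

end EC

/-- Regret and switching cost of the lazy-switching algorithm. The constants `c₀` and `p` are
universal, and `C` depends only on the constant `Ce` of the eluder condition. The first part is about
MDPs, the second about the max-player of a decoupled zero-sum Markov game whose opponent chooses the
policies `μ k`. -/
theorem theorem1 :
    ∃ c₀ : ℝ, 0 < c₀ ∧ ∃ p : ℕ, ∀ Ce : ℝ, 0 < Ce → ∃ C : ℝ, 0 < C ∧ ∀ c : ℝ, c₀ ≤ c →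
      (∀ (S A 𝓖 Ω : Type*) [MeasurableSpace S] [MeasurableSpace A] [MeasurableSpace 𝓖]
          [mΩ : MeasurableSpace Ω] (H m K : ℕ) (𝓕 : Set 𝓖) (M : EC.Model S A H)
          (πstar : EC.Policy S A) (Q : 𝓕 → ℕ → S × A → ℝ) (pol : 𝓕 → EC.Policy S A) (fstar : 𝓕)
          (ℓ : EC.Loss S A H m 𝓕) (R d κ δ β : ℝ)
          (Pr : Measure Ω) [IsProbabilityMeasure Pr]
          (ℱ : Filtration ℕ mΩ)
          (fs : ℕ → Ω → 𝓕) (conf : ℕ → Ω → Set 𝓕) (τ : ℕ → Ω → EC.Traj S A H),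
          1 ≤ H → 2 ≤ K → 0 < R → 0 ≤ d → 0 ≤ κ → 0 < δ → δ < 1 →
          EC.MeasurableLoss ℓ →
          EC.IsMDPClass M πstar Q pol fstar ℓ K R Ce d κ →
          EC.IsDecomposable M ℓ fstar →
          (∃ D, EC.IsSupCover (EC.lossClass ℓ) (1 / (K : ℝ)) D) →
          β = c * (R ^ 2 * Real.log
            (H * (K : ℝ) ^ 2 * EC.coveringNumber (EC.lossClass ℓ) (1 / (K : ℝ)) / δ) + R) →
          EC.IsInteraction Pr ℱ M ℓ (fun f => EC.hypValue (Q f) (pol f) 0 M.s₁) β K fs conf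
            (fun k ω => pol (fs k ω)) τ →
          Pr {ω | ¬ (EC.regret M (EC.value M πstar 0 M.s₁) (fun k => pol (fs k ω)) K
                  ≤ C * (κ * H * Real.sqrt (d * β * K) * Real.log K ^ p) ∧
                (EC.switchCost H (fun k => pol (fs k ω)) K : ℝ)
                  ≤ C * (d * H * Real.log K))} ≤ ENNReal.ofReal δ) ∧
      (∀ (S A B 𝓖 Ω : Type*) [MeasurableSpace S] [MeasurableSpace A] [MeasurableSpace B]
          [MeasurableSpace 𝓖] [mΩ : MeasurableSpace Ω] (H m K : ℕ) (𝓕 : Set 𝓖)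
          (M : EC.Model S (A × B) H) (υstar : EC.Policy S A) (μstar : EC.Policy S B)
          (Q : 𝓕 → ℕ → S × (A × B) → ℝ) (polA : 𝓕 → EC.Policy S A) (polB : 𝓕 → EC.Policy S B)
          (fstar : 𝓕) (ℓ : EC.Loss S (A × B) H m 𝓕) (R d κ δ β : ℝ)
          (Pr : Measure Ω) [IsProbabilityMeasure Pr]
          (ℱ : Filtration ℕ mΩ)
          (fs : ℕ → Ω → 𝓕) (conf : ℕ → Ω → Set 𝓕) (μ : ℕ → Ω → EC.Policy S B)
          (τ : ℕ → Ω → EC.Traj S (A × B) H),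
          1 ≤ H → 2 ≤ K → 0 < R → 0 ≤ d → 0 ≤ κ → 0 < δ → δ < 1 →
          EC.MeasurableLoss ℓ →
          EC.IsGameClass M υstar μstar Q polA polB fstar ℓ K R Ce d κ →
          EC.IsDecomposable M ℓ fstar →
          (∃ D, EC.IsSupCover (EC.lossClass ℓ) (1 / (K : ℝ)) D) →
          β = c * (R ^ 2 * Real.log
            (H * (K : ℝ) ^ 2 * EC.coveringNumber (EC.lossClass ℓ) (1 / (K : ℝ)) / δ) + R) →
          EC.IsInteraction Pr ℱ M ℓ
            (fun f => EC.hypValue (Q f) ((polA f).joint (polB f)) 0 M.s₁) β K fs conf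
            (fun k ω => (polA (fs k ω)).joint (μ k ω)) τ →
          Pr {ω | ¬ (EC.regret M (EC.value M (υstar.joint μstar) 0 M.s₁)
                  (fun k => (polA (fs k ω)).joint (μ k ω)) K
                  ≤ C * (κ * H * Real.sqrt (d * β * K) * Real.log K ^ p) ∧
                (EC.switchCost H (fun k => polA (fs k ω)) K : ℝ)
                  ≤ C * (d * H * Real.log K))} ≤ ENNReal.ofReal δ) := by
  refine ⟨1280, by norm_num, 1, fun Ce hCe => ⟨10 * Real.sqrt Ce + 7 * Ce, by positivity,
    fun c hc => ⟨?_, ?_⟩⟩⟩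
  · intro S A 𝓖 Ω _ _ _ mΩ H m K 𝓕 M πstar Q pol fstar ℓ R d κ δ β Pr _ ℱ fs conf τ hH hK hR hd hκ
      hδ hδ1 hmeas hcls hdec hcover hβ hint
    have hV : EC.value M πstar 0 M.s₁ = EC.hypValue (Q fstar) (pol fstar) 0 M.s₁ := by
      rw [hcls.realizable_V 0 hH]
    have hL : 0 ≤ Real.log K := Real.log_natCast_nonneg K
    refine (measure_mono ?_).trans
      (EC.measure_not_regret_and_switch_le hc hCe hH hK hR hd hκ hδ hδ1 hmeas hcls.ec hdec hcover hβ
        hint (fun k ω => Set.mem_singleton _))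
    intro ω hω hgood
    refine hω ?_
    rw [hV, pow_one]
    refine ⟨hgood.1.trans ?_, le_trans (Nat.cast_le.2
      (EC.switchCost_le_card_ne H pol _ K)) (hgood.2.trans ?_)⟩
    · exact mul_le_mul_of_nonneg_right (by linarith) (by positivity)
    · exact mul_le_mul_of_nonneg_right (by linarith [Real.sqrt_nonneg Ce]) (by positivity)
  · intro S A B 𝓖 Ω _ _ _ _ mΩ H m K 𝓕 M υstar μstar Q polA polB fstar ℓ R d κ δ β Pr _ ℱ fs conf μ τ
      hH hK hR hd hκ hδ hδ1 hmeas hcls hdec hcover hβ hint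
    have hV : EC.value M (υstar.joint μstar) 0 M.s₁
        = EC.hypValue (Q fstar) ((polA fstar).joint (polB fstar)) 0 M.s₁ := by
      rw [hcls.realizable_V 0 hH]
    have hL : 0 ≤ Real.log K := Real.log_natCast_nonneg K
    refine (measure_mono ?_).trans
      (EC.measure_not_regret_and_switch_le hc hCe hH hK hR hd hκ hδ hδ1 hmeas hcls.ec hdec hcover hβ
        hint (fun k ω => ⟨μ k ω, rfl⟩))
    intro ω hω hgood
    refine hω ?_
    rw [hV, pow_one]
    refine ⟨hgood.1.trans ?_, le_trans (Nat.cast_le.2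
      (EC.switchCost_le_card_ne H polA _ K)) (hgood.2.trans ?_)⟩
    · exact mul_le_mul_of_nonneg_right (by linarith) (by positivity)
    · exact mul_le_mul_of_nonneg_right (by linarith [Real.sqrt_nonneg Ce]) (by positivity)
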